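/- For integers $p\ge 1$ and $n\ge 0$ put $h_n^{(p)}=\sum_{j=1}^{n}\frac{1}{(j-1/2)^p}$ (so $h_0^{(p)}=0$). For integers $k\ge 1$, $p_1,\dots,p_k\ge 1$ and $q\ge 2$, the Euler $T$-sum of degree $k$ and weight $p_1+\cdots+p_k+q$ is $$T_{p_1p_2\cdots p_k,q}=\sum_{n=1}^{\infty}\frac{h_{n-1}^{(p_1)}h_{n-1}^{(p_2)}\cdots h_{n-1}^{(p_k)}}{(n-1/2)^q}.$$ For integers $r\ge 1$, $s_1\ge 2$ and $s_2,\dots,s_r\ge 1$, the multiple zeta value of depth $r$ is $$\zeta(s_1,\dots,s_r)=\sum_{n_1>\cdots>n_r\ge 1}\frac{1}{n_1^{s_1}\cdots n_r^{s_r}}.$$ **Theorem.** Let $k\ge 2$, $p_1,\dots,p_k\ge 1$ and $q\ge 2$ be integers such that the weight $p_1+\cdots+p_k+q$ and the degree $k$ have the same parity. Then the series defining $T_{p_1p_2\cdots p_k,q}$ converges, and its value is a polynomial with rational coefficients in $\log 2$, Euler $T$-sums of degree at most $k-1$ and multiple zeta values of depth at most $k$; that is, $T_{p_1p_2\cdots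 p_k,q}$ belongs to the $\mathbb{Q}$-subalgebra of $\mathbb{R}$ generated by $\log 2$, all Euler $T$-sums of degree at most $k-1$ and all multiple zeta values of depth at most $k$. -/

import Mathlib

/-- The odd harmonic number `h_n^{(p)} = ∑_{j=1}^n 1 / (j - 1/2)^p`, with `h_0^{(p)} = 0`. -/
noncomputable def oddHarmonic (p n : ℕ) : ℝ :=
  ∑ j ∈ Finset.Icc 1 n, 1 / ((j : ℝ) - 1 / 2) ^ p

/-- The summand `h_n^{(p_1)} ⋯ h_n^{(p_k)} / (n + 1/2)^q` of an Euler `T`-sum. The index starts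
at `n = 0`, so this is the usual summand `h_{m-1}^{(p_1)} ⋯ h_{m-1}^{(p_k)} / (m - 1/2)^q`
for `m = n + 1 ≥ 1`. -/
noncomputable def eulerTTerm {k : ℕ} (p : Fin k → ℕ) (q n : ℕ) : ℝ :=
  (∏ i, oddHarmonic (p i) n) / ((n : ℝ) + 1 / 2) ^ q

/-- The Euler `T`-sum
`T_{p_1 ⋯ p_k, q} = ∑_{m ≥ 1} h_{m-1}^{(p_1)} ⋯ h_{m-1}^{(p_k)} / (m - 1/2)^q`. -/
noncomputable def eulerT {k : ℕ} (p : Fin k → ℕ) (q : ℕ) : ℝ :=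
  ∑' n : ℕ, eulerTTerm p q n

/-- The truncated nested sum
`∑_{N > n_1 > ⋯ > n_r ≥ 1} 1 / (n_1^{s_1} ⋯ n_r^{s_r})`; it is `1` for the empty list. -/
noncomputable def mzvTrunc : List ℕ → ℕ → ℝ
  | [], _ => 1
  | s :: l, N => ∑ n ∈ Finset.Ico 1 N, 1 / (n : ℝ) ^ s * mzvTrunc l n

/-- The multiple zeta value
`ζ(a, s_2, …, s_r) = ∑_{n_1 > n_2 > ⋯ > n_r ≥ 1} 1 / (n_1^a n_2^{s_2} ⋯ n_r^{s_r})`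
with first exponent `a` and remaining exponents `l = [s_2, …, s_r]`; here `n_1 = n + 1`.
Its depth is `r = l.length + 1`. -/
noncomputable def mzv (a : ℕ) (l : List ℕ) : ℝ :=
  ∑' n : ℕ, 1 / ((n : ℝ) + 1) ^ a * mzvTrunc l (n + 1)

/-- The set of all Euler `T`-sums `T_{p_1 ⋯ p_j, q}` of degree `1 ≤ j ≤ d`,
with `p_1, …, p_j ≥ 1` and `q ≥ 2`. -/
def eulerTSumsOfDegreeLE (d : ℕ) : Set ℝ :=
  {x | ∃ (j : ℕ) (p : Fin j → ℕ) (q : ℕ),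
    1 ≤ j ∧ j ≤ d ∧ (∀ i, 1 ≤ p i) ∧ 2 ≤ q ∧ x = eulerT p q}

/-- The set of all (convergent) multiple zeta values `ζ(a, s_2, …, s_r)` of depth `1 ≤ r ≤ d`,
with `a ≥ 2` and `s_2, …, s_r ≥ 1`. -/
def mzvsOfDepthLE (d : ℕ) : Set ℝ :=
  {x | ∃ (a : ℕ) (l : List ℕ),
    2 ≤ a ∧ (∀ s ∈ l, 1 ≤ s) ∧ l.length + 1 ≤ d ∧ x = mzv a l}

/-!
The series is evaluated by partial fractions. Let `f_s(x)` be the limit, as `M → ∞`, of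
`∑_{j ≤ M} (x - j)^{-s}`, with `H_M` added if `s = 1`; up to normalization this is a polygamma
function with poles at the natural numbers. Consider the sum of the kernel
`x^{-q} f_{p_1}(x) ⋯ f_{p_k}(x)` over all half-integers `x`.

At a half-integer the functions `f_s` are odd harmonic numbers plus constants:
`f_s(n + 1/2) = h_{n+1}^{(s)} + c_s` and `f_s(-(n + 1/2)) = c_s - (-1)^s h_n^{(s)}`, where `c_1` is
`-2 log 2` and `c_s` is a rational multiple of `ζ(s)` for `s ≥ 2`. The products over `i` at
`x = n + 1/2` and at `x = -(n + 1/2)` have the same leading term `∏ h_n^{(p_i)} / (n + 1/2)^q`,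
precisely by the parity condition, so the sum is `2 T` plus `T`-sums of lower degree.

On the other hand a rational function with poles in `ℕ` is the sum of its Laurent tails, and
`∑_x (x - a)^{-m}` over the half-integers vanishes for odd `m` and is a rational multiple of `ζ(m)`
for even `m`. So the sum is `∑_a ∑_m` of Laurent coefficients of order `-m`, `m ≥ 2`, at the
integers `a ≥ 0`. At `a = 0` these are polynomials in zeta values. At `a ≥ 1`, as `m ≥ 2`, at least
one factor `f_{p_i}` contributes its polar term only, hence at most `k - 1` harmonic numbers `H_a`
occur, and the sum over `a ≥ 1` consists of multiple zeta values of depth at most `k` by the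
quasi-shuffle relation (`genHarm_mul_weightedSum`).

The identity is exact for the truncated kernel (`tendsto_sum_of_mem_poleSpan`,
`tsum_kernel_trunc`), and passes to the limit `M → ∞` by dominated convergence
(`Tame.tendsto_tsum`, `tsum_kernel`).
-/

open Filter Topology Finset

/-! ### Shifted harmonic sums -/

/-- The shifted harmonic sum `∑_{0 ≤ j < n} (j + θ)^{-s}`. -/
noncomputable def genHarm (θ : ℝ) (s n : ℕ) : ℝ :=
  ∑ j ∈ range n, ((j : ℝ) + θ)⁻¹ ^ s

lemma genHarm_zero (θ : ℝ) (s : ℕ) : genHarm θ s 0 = 0 := by simp [genHarm]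

lemma genHarm_succ (θ : ℝ) (s n : ℕ) :
    genHarm θ s (n + 1) = genHarm θ s n + ((n : ℝ) + θ)⁻¹ ^ s := by
  simp [genHarm, sum_range_succ]

lemma genHarm_add (θ : ℝ) (s m n : ℕ) :
    genHarm θ s (m + n) = genHarm θ s m + ∑ j ∈ range n, ((m + j : ℝ) + θ)⁻¹ ^ s := by
  simp [genHarm, sum_range_add]

lemma genHarm_nonneg {θ : ℝ} (hθ : 0 < θ) (s n : ℕ) : 0 ≤ genHarm θ s n :=
  sum_nonneg fun _ _ => by positivity

lemma genHarm_mono {θ : ℝ} (hθ : 0 < θ) (s : ℕ) : Monotone (genHarm θ s) := by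
  refine monotone_nat_of_le_succ fun n => ?_
  rw [genHarm_succ]
  have : 0 ≤ ((n : ℝ) + θ)⁻¹ ^ s := by positivity
  linarith

lemma genHarm_add_le {θ : ℝ} (hθ : 0 < θ) (s m n : ℕ) :
    genHarm θ s (m + n) ≤ genHarm θ s m + genHarm θ s n := by
  rw [genHarm_add]
  refine add_le_add_right (sum_le_sum fun j _ => ?_) _
  have : (j : ℝ) + θ ≤ m + j + θ := by linarith [(Nat.cast_nonneg m : (0 : ℝ) ≤ m)]
  gcongr

lemma oddHarmonic_eq_genHarm (p n : ℕ) : oddHarmonic p n = genHarm (1 / 2) p n := by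
  induction n with
  | zero => simp [oddHarmonic, genHarm]
  | succ n ih =>
    rw [genHarm_succ, ← ih, oddHarmonic, oddHarmonic, sum_Icc_succ_top (by omega)]
    congr 1
    push_cast
    rw [one_div, inv_pow]
    congr 2
    ring

lemma summable_inv_pow {θ : ℝ} (hθ : 0 < θ) {s : ℕ} (hs : 2 ≤ s) :
    Summable fun n : ℕ => ((n : ℝ) + θ)⁻¹ ^ s := by
  have h := (Real.summable_one_div_nat_add_rpow θ s).2 (by exact_mod_cast hs)
  refine h.congr fun n => ?_
  have : (0 : ℝ) < n + θ := by positivity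
  rw [abs_of_pos this, Real.rpow_natCast, one_div, inv_pow]

lemma tendsto_genHarm {θ : ℝ} (hθ : 0 < θ) {s : ℕ} (hs : 2 ≤ s) :
    Tendsto (genHarm θ s) atTop (𝓝 (∑' n : ℕ, ((n : ℝ) + θ)⁻¹ ^ s)) :=
  (summable_inv_pow hθ hs).hasSum.tendsto_sum_nat

lemma genHarm_one_one (n : ℕ) : genHarm 1 1 n = (harmonic n : ℝ) := by
  simp [genHarm, harmonic]

lemma genHarm_half_one (n : ℕ) :
    genHarm (1 / 2) 1 n = 2 * genHarm 1 1 (2 * n) - genHarm 1 1 n := by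
  induction n with
  | zero => simp [genHarm]
  | succ n ih =>
    rw [show 2 * (n + 1) = 2 * n + 1 + 1 by ring]
    simp only [genHarm_succ, ih]
    push_cast
    field_simp
    ring

/-- The source of `log 2`: both sums grow like `log n`, and the constants differ by `2 log 2`. -/
lemma tendsto_genHarm_sub :
    Tendsto (fun n => genHarm (1 / 2) 1 n - genHarm 1 1 n) atTop (𝓝 (2 * Real.log 2)) := by
  have h := Real.tendsto_harmonic_sub_log
  have h2 : Tendsto (fun n : ℕ => 2 * n) atTop atTop :=
    tendsto_id.const_mul_atTop' (by norm_num)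
  have h3 := ((h.comp h2).sub h).const_mul 2
  rw [sub_self, mul_zero] at h3
  have h4 := h3.add_const (2 * Real.log 2)
  rw [zero_add] at h4
  refine h4.congr' ?_
  filter_upwards [eventually_gt_atTop 0] with n hn
  have hn' : (n : ℝ) ≠ 0 := by positivity
  rw [genHarm_half_one, genHarm_one_one, genHarm_one_one]
  simp only [Function.comp]
  push_cast
  rw [Real.log_mul two_ne_zero hn']
  ring

/-! ### Families of sequences of logarithmic growth -/

/-- The logarithmic growth scale `1 + log (n + 1)`. -/
noncomputable def logScale (n : ℕ) : ℝ := 1 + Real.log (n + 1)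

lemma one_le_logScale (n : ℕ) : 1 ≤ logScale n := by
  have : 0 ≤ Real.log ((n : ℝ) + 1) := Real.log_nonneg (by simp)
  unfold logScale; linarith

lemma exists_genHarm_le {θ : ℝ} (hθ : 0 < θ) {s : ℕ} (hs : 1 ≤ s) :
    ∃ C, 0 ≤ C ∧ ∀ n, genHarm θ s (n + 1) ≤ C * logScale n := by
  refine ⟨θ⁻¹ ^ s + 1, by positivity, fun n => ?_⟩
  have h1 : genHarm θ s (n + 1) ≤ θ⁻¹ ^ s + genHarm 1 1 n := by
    rw [add_comm n, genHarm_add]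
    gcongr
    · simp [genHarm]
    · rw [genHarm]
      gcongr with j
      have : ((1 : ℕ) + j + θ : ℝ)⁻¹ ≤ ((j : ℝ) + 1)⁻¹ := by
        apply inv_anti₀ (by positivity)
        push_cast; linarith
      calc ((1 : ℕ) + j + θ : ℝ)⁻¹ ^ s ≤ ((1 : ℕ) + j + θ : ℝ)⁻¹ ^ 1 := by
            apply pow_le_pow_of_le_one (by positivity) _ hs
            apply inv_le_one_of_one_le₀
            push_cast
            have : (0 : ℝ) ≤ j := by positivity
            linarith
        _ ≤ _ := by gcongr
  have h2 : genHarm 1 1 n ≤ logScale n := by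
    calc genHarm 1 1 n ≤ genHarm 1 1 (n + 1) := genHarm_mono one_pos 1 (Nat.le_succ n)
      _ ≤ _ := by
        rw [genHarm_one_one, logScale]
        simpa using harmonic_le_one_add_log (n + 1)
  have h3 := one_le_logScale n
  have h4 : 0 ≤ θ⁻¹ ^ s := by positivity
  nlinarith

lemma summable_logScale_pow {θ : ℝ} (hθ : 0 < θ) {q : ℕ} (hq : 2 ≤ q) (d : ℕ) :
    Summable fun n : ℕ => logScale n ^ d * ((n : ℝ) + θ)⁻¹ ^ q := by
  have ho : (fun n : ℕ => logScale n ^ d * ((n : ℝ) + θ)⁻¹ ^ q) =O[atTop]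
      fun n : ℕ => (n : ℝ) ^ (-(3 / 2) : ℝ) := by
    have hcast : Tendsto (fun n : ℕ => (n : ℝ)) atTop atTop := tendsto_natCast_atTop_atTop
    have h1 : (fun n : ℕ => logScale n) =O[atTop] fun n : ℕ => Real.log n := by
      refine Asymptotics.IsBigO.of_bound 3 ?_
      filter_upwards [eventually_ge_atTop 3] with n hn
      have hn' : (3 : ℝ) ≤ n := by exact_mod_cast hn
      have hl : 1 ≤ Real.log n := by
        rw [Real.le_log_iff_exp_le (by linarith)]
        linarith [Real.exp_one_lt_d9]
      have h2 : Real.log (n + 1) ≤ Real.log n + Real.log 2 := by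
        rw [← Real.log_mul (by positivity) (by norm_num)]
        exact Real.log_le_log (by positivity) (by linarith)
      have h3 : Real.log 2 ≤ 1 := by linarith [Real.log_two_lt_d9]
      rw [Real.norm_of_nonneg (by linarith [one_le_logScale n]), Real.norm_of_nonneg (by linarith),
        logScale]
      linarith
    have h2 : (fun n : ℕ => logScale n ^ d) =O[atTop] fun n : ℕ => (n : ℝ) ^ (1 / 2 : ℝ) := by
      refine (h1.pow d).trans ?_
      have := (isLittleO_log_rpow_rpow_atTop (d : ℝ) (show (0 : ℝ) < 1 / 2 by norm_num)).isBigO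
      have := this.comp_tendsto hcast
      simpa [Function.comp_def, Real.rpow_natCast] using this
    have h3 : (fun n : ℕ => ((n : ℝ) + θ)⁻¹ ^ q) =O[atTop] fun n : ℕ => (n : ℝ) ^ (-2 : ℝ) := by
      refine Asymptotics.IsBigO.of_bound 1 ?_
      filter_upwards [eventually_ge_atTop 1] with n hn
      have hn' : (1 : ℝ) ≤ n := by exact_mod_cast hn
      rw [Real.norm_of_nonneg (by positivity), Real.norm_of_nonneg (by positivity), one_mul,
        Real.rpow_neg (by positivity), Real.rpow_ofNat, ← inv_pow]
      calc ((n : ℝ) + θ)⁻¹ ^ q ≤ ((n : ℝ) + θ)⁻¹ ^ 2 := by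
            apply pow_le_pow_of_le_one (by positivity) _ hq
            exact inv_le_one_of_one_le₀ (by linarith)
        _ ≤ _ := by
            gcongr
            linarith
    refine (h2.mul h3).congr' (EventuallyEq.refl _ _) ?_
    filter_upwards [eventually_ge_atTop 1] with n hn
    have hn' : (0 : ℝ) < n := by exact_mod_cast hn
    rw [← Real.rpow_add hn']
    norm_num
  exact summable_of_isBigO_nat (Real.summable_nat_rpow.2 (by norm_num)) ho

/-- A family `u M` of sequences converging pointwise to `v` with a bound by a power of `logScale`
that is uniform in `M`: the hypotheses under which the limit `M → ∞` passes through
`∑ u M n / (n + θ) ^ q`, `q ≥ 2`. -/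
def Tame (u : ℕ → ℕ → ℝ) (v : ℕ → ℝ) : Prop :=
  (∃ (C : ℝ) (d : ℕ), 0 ≤ C ∧ ∀ M n, |u M n| ≤ C * logScale n ^ d) ∧
    ∀ n, Tendsto (fun M => u M n) atTop (𝓝 (v n))

namespace Tame

variable {u u' : ℕ → ℕ → ℝ} {v v' : ℕ → ℝ}

lemma mul (h : Tame u v) (h' : Tame u' v') :
    Tame (fun M n => u M n * u' M n) fun n => v n * v' n := by
  obtain ⟨⟨C, d, hC, hb⟩, ht⟩ := h
  obtain ⟨⟨C', d', hC', hb'⟩, ht'⟩ := h'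
  refine ⟨⟨C * C', d + d', by positivity, fun M n => ?_⟩, fun n => (ht n).mul (ht' n)⟩
  rw [abs_mul, pow_add, mul_mul_mul_comm]
  exact mul_le_mul (hb M n) (hb' M n) (abs_nonneg _) ((abs_nonneg _).trans (hb M n))

lemma add (h : Tame u v) (h' : Tame u' v') :
    Tame (fun M n => u M n + u' M n) fun n => v n + v' n := by
  obtain ⟨⟨C, d, hC, hb⟩, ht⟩ := h
  obtain ⟨⟨C', d', hC', hb'⟩, ht'⟩ := h'
  refine ⟨⟨C + C', d + d', by positivity, fun M n => ?_⟩, fun n => (ht n).add (ht' n)⟩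
  have h1 := one_le_logScale n
  have h2 : logScale n ^ d ≤ logScale n ^ (d + d') := pow_le_pow_right₀ h1 (by omega)
  have h3 : logScale n ^ d' ≤ logScale n ^ (d + d') := pow_le_pow_right₀ h1 (by omega)
  calc |u M n + u' M n| ≤ |u M n| + |u' M n| := abs_add_le _ _
    _ ≤ C * logScale n ^ d + C' * logScale n ^ d' := add_le_add (hb M n) (hb' M n)
    _ ≤ C * logScale n ^ (d + d') + C' * logScale n ^ (d + d') := by gcongr
    _ = _ := by ring

lemma of_seq {c : ℕ → ℝ} {x : ℝ} (h : Tendsto c atTop (𝓝 x)) :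
    Tame (fun M _ => c M) fun _ => x := by
  obtain ⟨C, hC⟩ := h.abs.bddAbove_range
  refine ⟨⟨C, 0, (abs_nonneg (c 0)).trans (hC ⟨0, rfl⟩), fun M n => ?_⟩, fun n => h⟩
  simpa using hC ⟨M, rfl⟩

lemma const (x : ℝ) : Tame (fun _ _ => x) fun _ => x := of_seq tendsto_const_nhds

lemma of_bound {C : ℝ} (hC : 0 ≤ C) (hb : ∀ n, |v n| ≤ C * logScale n) :
    Tame (fun _ n => v n) v :=
  ⟨⟨C, 1, hC, fun _ n => by simpa using hb n⟩, fun _ => tendsto_const_nhds⟩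

lemma sum {ι : Type*} (s : Finset ι) {u : ι → ℕ → ℕ → ℝ} {v : ι → ℕ → ℝ}
    (h : ∀ i ∈ s, Tame (u i) (v i)) :
    Tame (fun M n => ∑ i ∈ s, u i M n) fun n => ∑ i ∈ s, v i n := by
  classical
  induction s using Finset.induction_on with
  | empty => simpa using const 0
  | insert i s hi ih =>
    simp only [sum_insert hi]
    exact (h i (mem_insert_self _ _)).add (ih fun j hj => h j (mem_insert_of_mem hj))

lemma prod {ι : Type*} (s : Finset ι) {u : ι → ℕ → ℕ → ℝ} {v : ι → ℕ → ℝ}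
    (h : ∀ i ∈ s, Tame (u i) (v i)) :
    Tame (fun M n => ∏ i ∈ s, u i M n) fun n => ∏ i ∈ s, v i n := by
  classical
  induction s using Finset.induction_on with
  | empty => simpa using const 1
  | insert i s hi ih =>
    simp only [prod_insert hi]
    exact (h i (mem_insert_self _ _)).mul (ih fun j hj => h j (mem_insert_of_mem hj))

lemma summable (h : Tame u v) {θ : ℝ} (hθ : 0 < θ) {q : ℕ} (hq : 2 ≤ q) (M : ℕ) :
    Summable fun n : ℕ => u M n * ((n : ℝ) + θ)⁻¹ ^ q := by
  obtain ⟨⟨C, d, hC, hb⟩, -⟩ := h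
  refine Summable.of_norm_bounded ((summable_logScale_pow hθ hq d).mul_left C) fun n => ?_
  rw [norm_mul, Real.norm_eq_abs, Real.norm_of_nonneg (by positivity), ← mul_assoc]
  gcongr
  exact hb M n

/-- Tannery's theorem for tame families. -/
lemma tendsto_tsum (h : Tame u v) {θ : ℝ} (hθ : 0 < θ) {q : ℕ} (hq : 2 ≤ q) :
    Tendsto (fun M => ∑' n : ℕ, u M n * ((n : ℝ) + θ)⁻¹ ^ q) atTop
      (𝓝 (∑' n : ℕ, v n * ((n : ℝ) + θ)⁻¹ ^ q)) := by
  obtain ⟨⟨C, d, hC, hb⟩, ht⟩ := h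
  refine tendsto_tsum_of_dominated_convergence ((summable_logScale_pow hθ hq d).mul_left C)
    (fun n => (ht n).mul_const _) (Eventually.of_forall fun M n => ?_)
  rw [norm_mul, Real.norm_eq_abs, Real.norm_of_nonneg (by positivity), ← mul_assoc]
  gcongr
  exact hb M n

end Tame

lemma tame_genHarm {θ : ℝ} (hθ : 0 < θ) {s : ℕ} (hs : 1 ≤ s) :
    Tame (fun _ n => genHarm θ s n) fun n => genHarm θ s n := by
  obtain ⟨C, hC, hb⟩ := exists_genHarm_le hθ hs
  exact .of_bound hC fun n => by
    rw [abs_of_nonneg (genHarm_nonneg hθ _ _)]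
    exact (genHarm_mono hθ s (Nat.le_succ n)).trans (hb n)

/-! ### Rational functions with poles at the natural numbers -/

/-- The expansion of `x - c` at the point `c + d`: the Laurent series `X + d`. -/
noncomputable def linearAt (d : ℝ) : LaurentSeries ℝ :=
  HahnSeries.ofPowerSeries ℤ ℝ (PowerSeries.X + PowerSeries.C d)

lemma linearAt_ne_zero (d : ℝ) : linearAt d ≠ 0 := by
  intro h
  have h1 : (PowerSeries.X + PowerSeries.C d : PowerSeries ℝ) = 0 :=
    HahnSeries.ofPowerSeries_injective (Γ := ℤ) (by simpa [linearAt] using h)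
  simpa [PowerSeries.coeff_X, PowerSeries.coeff_C] using congrArg (PowerSeries.coeff 1) h1

lemma linearAt_add (d e : ℝ) : linearAt (d + e) = linearAt d + HahnSeries.C e := by
  simp [linearAt, map_add, add_assoc]

/-- The ring in which a rational function with poles in `ℕ` is recorded by its values at the
half-integers `n + 1/2` and by its Laurent expansions at the natural numbers. Arithmetic with
these data replaces the uniqueness of partial fraction expansions. -/
abbrev PoleRing : Type := (ℤ → ℝ) × (ℕ → LaurentSeries ℝ)

/-- The rational function `1 / (x - b)`. -/
noncomputable def simplePole (b : ℕ) : PoleRing :=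
  (fun n => ((n : ℝ) + 1 / 2 - b)⁻¹, fun a => (linearAt ((a : ℝ) - b))⁻¹)

lemma half_sub_ne_zero (n : ℤ) (b : ℕ) : (n : ℝ) + 1 / 2 - b ≠ 0 := by
  intro h
  have h1 : (2 * n + 1 - 2 * b : ℝ) = 0 := by linarith
  have h2 : (2 * n + 1 - 2 * b : ℤ) = 0 := by exact_mod_cast h1
  omega

/-- The constant rational functions. -/
noncomputable def constFun : ℝ →+* PoleRing :=
  (Pi.constRingHom ℤ ℝ).prod ((Pi.constRingHom ℕ (LaurentSeries ℝ)).comp HahnSeries.C)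

lemma constFun_fst (c : ℝ) (n : ℤ) : (constFun c).1 n = c := rfl

lemma constFun_snd (c : ℝ) (a : ℕ) : (constFun c).2 a = HahnSeries.C c := rfl

lemma simplePole_mul {b c : ℕ} (h : b ≠ c) :
    simplePole b * simplePole c = constFun ((b : ℝ) - c)⁻¹ * (simplePole b - simplePole c) := by
  have hbc : (b : ℝ) - c ≠ 0 := by
    rw [sub_ne_zero]; exact_mod_cast h
  have key : constFun ((b : ℝ) - c) * (simplePole b * simplePole c) =
      simplePole b - simplePole c := by
    ext1
    · funext n
      have h1 := half_sub_ne_zero n b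
      have h2 := half_sub_ne_zero n c
      simp only [Prod.fst_mul, Prod.fst_sub, Pi.mul_apply, Pi.sub_apply, constFun_fst, simplePole]
      rw [inv_sub_inv h1 h2, eq_div_iff (mul_ne_zero h1 h2), ← mul_inv, mul_assoc,
        inv_mul_cancel₀ (mul_ne_zero h1 h2)]
      ring
    · funext a
      have h1 := linearAt_ne_zero ((a : ℝ) - b)
      have h2 := linearAt_ne_zero ((a : ℝ) - c)
      simp only [Prod.snd_mul, Prod.snd_sub, Pi.mul_apply, Pi.sub_apply, constFun_snd, simplePole]
      have h3 : linearAt ((a : ℝ) - c) = linearAt ((a : ℝ) - b) + HahnSeries.C ((b : ℝ) - c) := by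
        rw [← linearAt_add]; congr 1; ring
      rw [inv_sub_inv h1 h2, eq_div_iff (mul_ne_zero h1 h2), ← mul_inv, mul_assoc,
        inv_mul_cancel₀ (mul_ne_zero h1 h2), h3]
      ring
  rw [← key, ← mul_assoc, ← map_mul, inv_mul_cancel₀ hbc, map_one, one_mul]

/-- The rational functions vanishing at infinity whose poles lie in `{0, …, M}`. -/
noncomputable def poleSpan (M : ℕ) : AddSubmonoid PoleRing :=
  AddSubmonoid.closure {F | ∃ (c : ℝ) (b m : ℕ), b ≤ M ∧ 1 ≤ m ∧ F = constFun c * simplePole b ^ m}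

lemma const_mul_mem_poleSpan {M : ℕ} (c : ℝ) {F : PoleRing} (hF : F ∈ poleSpan M) :
    constFun c * F ∈ poleSpan M := by
  induction hF using AddSubmonoid.closure_induction with
  | mem F h =>
    obtain ⟨d, b, m, hb, hm, rfl⟩ := h
    rw [← mul_assoc, ← map_mul]
    exact AddSubmonoid.subset_closure ⟨c * d, b, m, hb, hm, rfl⟩
  | zero => rw [mul_zero]; exact zero_mem _
  | add F G _ _ hF hG => rw [mul_add]; exact add_mem hF hG

lemma simplePole_pow_mem {M b m : ℕ} (hb : b ≤ M) (hm : 1 ≤ m) : simplePole b ^ m ∈ poleSpan M :=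
  AddSubmonoid.subset_closure ⟨1, b, m, hb, hm, by rw [map_one, one_mul]⟩

/-- Partial fractions for two poles, by induction on the total order `m + l = N + 1`. -/
lemma simplePole_pow_mul_pow_mem {M b c : ℕ} (hb : b ≤ M) (hc : c ≤ M) :
    ∀ N m l : ℕ, m + l = N + 1 → simplePole b ^ m * simplePole c ^ l ∈ poleSpan M := by
  rcases eq_or_ne b c with rfl | hbc
  · intro N m l h
    rw [← pow_add]
    exact simplePole_pow_mem hb (by omega)
  · intro N
    induction N with
    | zero =>
      intro m l h
      obtain ⟨rfl, rfl⟩ | ⟨rfl, rfl⟩ : (m = 0 ∧ l = 1) ∨ (m = 1 ∧ l = 0) := by omega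
      · rw [pow_zero, one_mul]; exact simplePole_pow_mem hc le_rfl
      · rw [pow_zero, mul_one]; exact simplePole_pow_mem hb le_rfl
    | succ N ih =>
      intro m l h
      rcases m with _ | m
      · rw [pow_zero, one_mul]
        exact simplePole_pow_mem hc (by omega)
      rcases l with _ | l
      · rw [pow_zero, mul_one]
        exact simplePole_pow_mem hb (by omega)
      have : simplePole b ^ (m + 1) * simplePole c ^ (l + 1) = constFun ((b : ℝ) - c)⁻¹ *
          (simplePole b ^ (m + 1) * simplePole c ^ l +
            constFun (-1) * (simplePole b ^ m * simplePole c ^ (l + 1))) := by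
        calc _ = simplePole b ^ m * simplePole c ^ l * (simplePole b * simplePole c) := by ring
          _ = _ := by rw [simplePole_mul hbc, map_neg, map_one]; ring
      rw [this]
      exact const_mul_mem_poleSpan _ (add_mem (ih _ _ (by omega))
        (const_mul_mem_poleSpan _ (ih _ _ (by omega))))

lemma poleSpan_mul {M : ℕ} {F G : PoleRing} (hF : F ∈ poleSpan M) (hG : G ∈ poleSpan M) :
    F * G ∈ poleSpan M := by
  induction hF using AddSubmonoid.closure_induction with
  | mem F h =>
    obtain ⟨c, b, m, hb, hm, rfl⟩ := h
    rw [mul_assoc]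
    refine const_mul_mem_poleSpan c ?_
    induction hG using AddSubmonoid.closure_induction with
    | mem G h =>
      obtain ⟨d, b', l, hb', hl, rfl⟩ := h
      rw [mul_left_comm]
      exact const_mul_mem_poleSpan d
        (simplePole_pow_mul_pow_mem hb hb' (m + l - 1) m l (by omega))
    | zero => rw [mul_zero]; exact zero_mem _
    | add F G _ _ hF hG => rw [mul_add]; exact add_mem hF hG
  | zero => rw [zero_mul]; exact zero_mem _
  | add F G _ _ hF hG => rw [add_mul]; exact add_mem hF hG

/-! ### Summing partial fractions over the half-integers -/

/-- The sum of `x ^ (-m)` over the half-integers, in the symmetric sense if `m = 1`. For `m = 1`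
the junk value of the divergent series is multiplied by `0`. -/
noncomputable def halfLatticeSum (m : ℕ) : ℝ :=
  (1 + (-1) ^ m) * ∑' n : ℕ, ((n : ℝ) + 1 / 2)⁻¹ ^ m

/-- The symmetric sum does not depend on the integer translation `b`: translating by one changes
the partial sums by boundary terms that tend to `0`. -/
lemma tendsto_symmetric_sum {m : ℕ} (hm : 1 ≤ m) (b : ℕ) :
    Tendsto (fun N : ℕ => ∑ n ∈ range N,
      ((((n : ℤ) : ℝ) + 1 / 2 - b)⁻¹ ^ m + (((-(n + 1) : ℤ) : ℝ) + 1 / 2 - b)⁻¹ ^ m))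
      atTop (𝓝 (halfLatticeSum m)) := by
  induction b with
  | zero =>
    have hterm : ∀ n : ℕ,
        (((n : ℤ) : ℝ) + 1 / 2 - (0 : ℕ))⁻¹ ^ m + (((-(n + 1) : ℤ) : ℝ) + 1 / 2 - (0 : ℕ))⁻¹ ^ m
          = (1 + (-1) ^ m) * ((n : ℝ) + 1 / 2)⁻¹ ^ m := by
      intro n
      have : (((-(n + 1) : ℤ) : ℝ) + 1 / 2 - (0 : ℕ)) = -((n : ℝ) + 1 / 2) := by push_cast; ring
      rw [this, inv_neg, neg_pow]
      push_cast
      ring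
    simp only [hterm, ← mul_sum]
    rcases hm.eq_or_lt with rfl | hm2
    · simp [halfLatticeSum]
    · exact (tendsto_genHarm (by norm_num) hm2).const_mul _
  | succ b ih =>
    have hzero1 : Tendsto (fun N : ℕ => (((-(N + 1) : ℤ) : ℝ) + 1 / 2 - b)⁻¹ ^ m) atTop (𝓝 0) := by
      have : Tendsto (fun N : ℕ => (((-(N + 1) : ℤ) : ℝ) + 1 / 2 - b)) atTop atBot := by
        have h0 := tendsto_neg_atTop_atBot.comp (tendsto_natCast_atTop_atTop (R := ℝ))
        have := tendsto_atBot_add_const_right _ (-1 + 1 / 2 - b : ℝ) h0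
        refine this.congr fun N => ?_
        simp only [Function.comp]; push_cast; ring
      simpa [show m ≠ 0 by omega] using (tendsto_inv_atBot_zero.comp this).pow m
    have hzero2 : Tendsto (fun N : ℕ => ((N : ℝ) - 1 / 2 - b)⁻¹ ^ m) atTop (𝓝 0) := by
      have : Tendsto (fun N : ℕ => ((N : ℝ) - 1 / 2 - b)) atTop atTop := by
        have := tendsto_atTop_add_const_right _ (- 1 / 2 - b : ℝ)
          (tendsto_natCast_atTop_atTop (R := ℝ))
        refine this.congr fun N => ?_
        ring
      simpa [show m ≠ 0 by omega] using (tendsto_inv_atTop_zero.comp this).pow m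
    have := (ih.add hzero1).sub hzero2
    rw [add_zero, sub_zero] at this
    refine this.congr fun N => ?_
    induction N with
    | zero =>
      simp only [range_zero, sum_empty, zero_add]
      push_cast
      ring
    | succ N ihN =>
      rw [sum_range_succ, sum_range_succ, ← ihN]
      push_cast
      have e1 : (-((N : ℝ) + 1) + 1 / 2 - (b + 1)) = -((N : ℝ) + 1 + 1) + 1 / 2 - b := by ring
      have e2 : ((N : ℝ) + 1 / 2 - (b + 1)) = N - 1 / 2 - b := by ring
      have e3 : ((N : ℝ) + 1 - 1 / 2 - b) = N + 1 / 2 - b := by ring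
      rw [e1, e2, e3]
      ring

/-- The contribution of a Laurent tail `∑ c_m X^{-m}`, truncated at `m ≤ B`, to the sum over the
half-integers. -/
noncomputable def tailSum (B : ℕ) (f : LaurentSeries ℝ) : ℝ :=
  ∑ m ∈ Icc 1 B, halfLatticeSum m * f.coeff (-(m : ℤ))

lemma tailSum_ofPowerSeries (B : ℕ) (g : PowerSeries ℝ) :
    tailSum B (HahnSeries.ofPowerSeries ℤ ℝ g) = 0 := by
  refine sum_eq_zero fun m hm => ?_
  have hm1 := (mem_Icc.1 hm).1
  rw [HahnSeries.ofPowerSeries_apply, HahnSeries.embDomain_of_notMem_range, mul_zero]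
  rintro ⟨n, hn⟩
  simp at hn
  omega

lemma inv_linearAt_zero_pow (p : ℕ) : (linearAt 0)⁻¹ ^ p = HahnSeries.single (-(p : ℤ)) (1 : ℝ) := by
  have : linearAt 0 = HahnSeries.single (1 : ℤ) (1 : ℝ) := by
    simp [linearAt, HahnSeries.ofPowerSeries_X]
  rw [this, HahnSeries.inv_single, inv_one, HahnSeries.single_pow, one_pow]
  simp

/-- The power series of `1 / (d + X)`. -/
noncomputable def invLinear (d : ℝ) : PowerSeries ℝ :=
  PowerSeries.mk fun l => (-1) ^ l * d⁻¹ ^ (l + 1)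

lemma inv_linearAt {d : ℝ} (hd : d ≠ 0) :
    (linearAt d)⁻¹ = HahnSeries.ofPowerSeries ℤ ℝ (invLinear d) := by
  refine inv_eq_of_mul_eq_one_left ?_
  rw [linearAt, ← map_mul, ← map_one (HahnSeries.ofPowerSeries ℤ ℝ)]
  congr 1
  ext l
  rcases l with _ | l
  · simp [invLinear, mul_add, hd]
  · rw [mul_add, map_add, PowerSeries.coeff_succ_mul_X, mul_comm, PowerSeries.coeff_C_mul]
    simp [invLinear, PowerSeries.coeff_one]
    field_simp
    ring

/-- The coefficients of `(1 + X) ^ (-p)`. -/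
noncomputable def invPowCoeff (p l : ℕ) : ℚ :=
  PowerSeries.coeff l ((PowerSeries.mk fun l => (-1 : ℚ) ^ l) ^ p)

lemma invPowCoeff_zero (p : ℕ) : invPowCoeff p 0 = 1 := by
  simp [invPowCoeff]

lemma coeff_invLinear_pow (d : ℝ) (p l : ℕ) :
    PowerSeries.coeff l (invLinear d ^ p) = invPowCoeff p l * d⁻¹ ^ (p + l) := by
  have h : invLinear d = PowerSeries.C d⁻¹ * PowerSeries.rescale d⁻¹
      (PowerSeries.map (algebraMap ℚ ℝ) (PowerSeries.mk fun l => (-1 : ℚ) ^ l)) := by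
    ext l
    simp [invLinear, PowerSeries.coeff_C_mul, PowerSeries.coeff_rescale, pow_succ]
    ring
  rw [h, mul_pow, ← map_pow, ← map_pow, ← map_pow, PowerSeries.coeff_C_mul,
    PowerSeries.coeff_rescale, PowerSeries.coeff_map, pow_add]
  simp [invPowCoeff]
  ring

lemma tailSum_simplePole {b a s B : ℕ} (hs : 1 ≤ s) (hB : s ≤ B) :
    tailSum B ((linearAt ((a : ℝ) - b))⁻¹ ^ s) = if a = b then halfLatticeSum s else 0 := by
  split_ifs with h
  · subst h
    rw [sub_self, inv_linearAt_zero_pow, tailSum, sum_eq_single s]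
    · simp
    · intro m _ hm
      rw [HahnSeries.coeff_single_of_ne (by omega), mul_zero]
    · intro hs'
      simp at hs'
      omega
  · have : (a : ℝ) - b ≠ 0 := by rw [sub_ne_zero]; exact_mod_cast h
    rw [inv_linearAt this, ← map_pow, tailSum_ofPowerSeries]

/-- The partial fraction expansion of `F`, summed over the half-integers. The truncation `B` only
has to exceed the orders of the poles of `F`. -/
theorem tendsto_sum_of_mem_poleSpan {M : ℕ} {F : PoleRing} (hF : F ∈ poleSpan M) :
    ∀ᶠ B in atTop, Tendsto (fun N : ℕ => ∑ n ∈ range N, (F.1 n + F.1 (-(n + 1)))) atTop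
      (𝓝 (∑ a ∈ range (M + 1), tailSum B (F.2 a))) := by
  induction hF using AddSubmonoid.closure_induction with
  | mem F h =>
    obtain ⟨c, b, s, hb, hs, rfl⟩ := h
    filter_upwards [eventually_ge_atTop s] with B hB
    have : ∑ a ∈ range (M + 1), tailSum B ((constFun c * simplePole b ^ s).2 a) =
        c * halfLatticeSum s := by
      have h (a : ℕ) : tailSum B ((constFun c * simplePole b ^ s).2 a) =
          c * if a = b then halfLatticeSum s else 0 := by
        rw [← tailSum_simplePole hs hB]
        simp only [tailSum, mul_sum, Prod.snd_mul, Pi.mul_apply, constFun_snd, HahnSeries.C_apply,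
          HahnSeries.coeff_single_zero_mul, simplePole, Prod.pow_snd, Pi.pow_apply]
        exact sum_congr rfl fun _ _ => mul_left_comm _ _ _
      simp only [h, ← mul_sum]
      rw [sum_ite_eq', if_pos (mem_range.2 (by omega))]
    rw [this]
    have h := (tendsto_symmetric_sum hs b).const_mul c
    refine h.congr fun N => ?_
    rw [mul_sum]
    refine sum_congr rfl fun n _ => ?_
    simp only [Prod.fst_mul, Pi.mul_apply, constFun_fst, simplePole, Prod.pow_fst, Pi.pow_apply]
    ring
  | zero => simp [tailSum]
  | add F G _ _ hF hG =>
    filter_upwards [hF, hG] with B h1 h2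
    have := h1.add h2
    simp only [← sum_add_distrib] at this
    convert this using 2
    · refine sum_congr rfl fun n _ => ?_
      simp only [Prod.fst_add, Pi.add_apply]; ring
    · refine sum_congr rfl fun a _ => ?_
      simp [tailSum, mul_add, sum_add_distrib]

/-! ### The truncated kernel -/

/-- The constant `H_M` that regularizes `∑_{j ≤ M} (x - j)^{-s}` for `s = 1`. -/
noncomputable def regConst (s M : ℕ) : ℝ := if s = 1 then genHarm 1 1 M else 0

/-- The rational function `∑_{j ≤ M} (x - j)^{-s}`, regularized for `s = 1`: a truncated
polygamma function. -/
noncomputable def truncPolygamma (s M : ℕ) : PoleRing :=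
  ∑ j ∈ range (M + 1), simplePole j ^ s + constFun (regConst s M)

/-- The rational function `x ^ (-q) ∏ᵢ f_{p i}(x)` with `f_s` the truncated polygamma functions. -/
noncomputable def kernelFun {k : ℕ} (p : Fin k → ℕ) (q M : ℕ) : PoleRing :=
  simplePole 0 ^ q * ∏ i, truncPolygamma (p i) M

lemma kernelFun_mem_poleSpan {k : ℕ} {p : Fin k → ℕ} {q : ℕ} (hp : ∀ i, 1 ≤ p i) (hq : 1 ≤ q)
    (M : ℕ) : kernelFun p q M ∈ poleSpan M := by
  unfold kernelFun
  have h (s : Finset (Fin k)) :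
      simplePole 0 ^ q * ∏ i ∈ s, truncPolygamma (p i) M ∈ poleSpan M := by
    induction s using Finset.induction_on with
    | empty =>
      rw [prod_empty, mul_one]
      exact simplePole_pow_mem (Nat.zero_le _) hq
    | insert i s hi ih =>
      rw [prod_insert hi, mul_left_comm, truncPolygamma, add_mul]
      refine add_mem (poleSpan_mul (sum_mem fun j hj => ?_) ih) (const_mul_mem_poleSpan _ ih)
      exact simplePole_pow_mem (by simpa [Nat.lt_succ_iff] using hj) (hp i)
  exact h univ

/-! ### Laurent expansions of the kernel -/

/-- The sum `∑ (a - j)^{-s}` over `j ≤ M`, `j ≠ a`, regularized for `s = 1`. -/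
noncomputable def shiftHarm (s M a : ℕ) : ℝ :=
  genHarm 1 s a + (-1) ^ s * genHarm 1 s (M - a) + regConst s M

/-- The term `j = a` of the sum is the junk value `0⁻¹ ^ s = 0`. -/
lemma sum_inv_sub_pow {s M a : ℕ} (hs : 1 ≤ s) (ha : a ≤ M) :
    ∑ j ∈ range (M + 1), ((a : ℝ) - j)⁻¹ ^ s
      = genHarm 1 s a + (-1) ^ s * genHarm 1 s (M - a) := by
  obtain ⟨d, rfl⟩ := Nat.exists_eq_add_of_le ha
  rw [add_assoc, sum_range_add, sum_range_succ', Nat.add_sub_cancel_left]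
  congr 1
  · rw [genHarm, ← sum_range_reflect]
    refine sum_congr rfl fun j hj => ?_
    have hj' : j < a := mem_range.1 hj
    congr 2
    rw [Nat.sub_sub, Nat.cast_sub (by omega)]
    push_cast
    ring
  · rw [genHarm, mul_sum]
    have h0 : ((a : ℝ) - (a + 0 : ℕ))⁻¹ ^ s = 0 := by
      simp; omega
    rw [h0, add_zero]
    refine sum_congr rfl fun j _ => ?_
    rw [← mul_pow]
    congr 1
    push_cast
    rw [show (a : ℝ) - (a + (j + 1)) = -(j + 1) by ring, inv_neg]
    ring

/-- The power series `g` such that `X ^ (-s) * g` is the expansion at a natural number `a` of a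
(truncated) polygamma function with pole of order `s`. Here `H l` stands for the (regularized) sum
of `(a - j) ^ (-l)` over the other poles `j`. -/
noncomputable def localSeries (s : ℕ) (H : ℕ → ℝ) : PowerSeries ℝ :=
  PowerSeries.mk fun l =>
    if l = 0 then 1 else if l < s then 0 else invPowCoeff s (l - s) * H l

/-- The pole `j = a` gives the `1` in `localSeries`, the other poles give a power series. -/
lemma truncPolygamma_snd {s M a : ℕ} (hs : 1 ≤ s) (ha : a ≤ M) :
    (truncPolygamma s M).2 a = (linearAt 0)⁻¹ ^ s *
      HahnSeries.ofPowerSeries ℤ ℝ (localSeries s fun l => shiftHarm l M a) := by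
  have h1 : localSeries s (fun l => shiftHarm l M a) = 1 + PowerSeries.X ^ s *
      (∑ j ∈ (range (M + 1)).erase a, invLinear ((a : ℝ) - j) ^ s +
        PowerSeries.C (regConst s M)) := by
    ext l
    rw [map_add, PowerSeries.coeff_X_pow_mul', PowerSeries.coeff_one, localSeries,
      PowerSeries.coeff_mk]
    rcases Nat.eq_zero_or_pos l with rfl | hl
    · simp; omega
    · rw [if_neg hl.ne', if_neg hl.ne', zero_add]
      by_cases hls : l < s
      · rw [if_pos hls, if_neg (by omega)]
      · rw [if_neg hls, if_pos (by omega), map_add, map_sum]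
        simp only [coeff_invLinear_pow]
        rw [show s + (l - s) = l by omega, ← mul_sum, sum_erase _ (by simp; omega),
          sum_inv_sub_pow hl ha, PowerSeries.coeff_C, shiftHarm, mul_add _ _ (regConst l M)]
        congr 1
        unfold regConst
        by_cases hl1 : l = 1
        · have : s = 1 := by omega
          subst this; subst hl1
          simp [invPowCoeff_zero]
        · rw [if_neg hl1, mul_zero]
          split_ifs with h3 h4
          · omega
          · rfl
          · rfl
  have h0 := linearAt_ne_zero 0
  have hX : HahnSeries.ofPowerSeries ℤ ℝ PowerSeries.X = linearAt 0 := by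
    simp [linearAt]
  rw [h1, map_add, map_one, map_mul, map_pow, hX, mul_add, mul_one, ← mul_assoc, ← mul_pow,
    inv_mul_cancel₀ h0, one_pow, one_mul, map_add, map_sum, HahnSeries.ofPowerSeries_C,
    truncPolygamma, Prod.snd_add, Pi.add_apply, constFun_snd, ← add_assoc, Prod.snd_sum,
    Finset.sum_apply, ← add_sum_erase _ _ (mem_range.2 (Nat.lt_succ_of_le ha))]
  congr 1
  congr 1
  · simp [simplePole]
  · refine sum_congr rfl fun j hj => ?_
    have : (a : ℝ) - j ≠ 0 := by
      rw [sub_ne_zero]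
      exact_mod_cast (ne_of_mem_erase hj).symm
    rw [map_pow, ← inv_linearAt this]
    rfl

/-- The term `m = 1` drops out because `halfLatticeSum 1 = 0`. This keeps the coefficient index
below `P`, on which the bound for the depth rests. -/
lemma tailSum_shift {P B : ℕ} (hB : P ≤ B) (g : PowerSeries ℝ) :
    tailSum B ((linearAt 0)⁻¹ ^ P * HahnSeries.ofPowerSeries ℤ ℝ g) =
      ∑ m ∈ Icc 2 P, halfLatticeSum m * PowerSeries.coeff (P - m) g := by
  rw [tailSum, inv_linearAt_zero_pow]
  have hsub : Icc 2 P ⊆ Icc 1 B := Icc_subset_Icc (by norm_num) hB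
  rw [← sum_subset hsub]
  · refine sum_congr rfl fun m hm => ?_
    have := (mem_Icc.1 hm).2
    rw [HahnSeries.coeff_single_mul, one_mul,
      show (-(m : ℤ) - -(P : ℤ)) = ((P - m : ℕ) : ℤ) by omega,
      HahnSeries.ofPowerSeries_apply_coeff]
  · intro m hm hm'
    rw [mem_Icc] at hm hm'
    rcases hm.1.eq_or_lt with rfl | h2
    · simp [halfLatticeSum]
    · rw [HahnSeries.coeff_single_mul, one_mul, HahnSeries.ofPowerSeries_apply,
        HahnSeries.embDomain_of_notMem_range, mul_zero]
      rintro ⟨n, hn⟩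
      simp at hn
      omega

lemma tailSum_kernelFun_succ {k : ℕ} {p : Fin k → ℕ} (hp : ∀ i, 1 ≤ p i) {q M n B : ℕ}
    (hn : n < M) (hB : ∑ i, p i ≤ B) :
    tailSum B ((kernelFun p q M).2 (n + 1)) =
      ∑ m ∈ Icc 2 (∑ i, p i), halfLatticeSum m * PowerSeries.coeff (∑ i, p i - m)
        (invLinear ((n : ℝ) + 1) ^ q * ∏ i, localSeries (p i) fun l => shiftHarm l M (n + 1)) := by
  rw [← tailSum_shift hB]
  congr 1
  have h1 : (n : ℝ) + 1 ≠ 0 := by positivity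
  rw [kernelFun, Prod.snd_mul, Pi.mul_apply, Prod.snd_prod, Finset.prod_apply,
    prod_congr rfl fun i _ => truncPolygamma_snd (hp i) (Nat.succ_le_of_lt hn),
    prod_mul_distrib, prod_pow_eq_pow_sum, map_mul, map_prod, map_pow, ← inv_linearAt h1]
  simp [simplePole]
  ring

lemma tailSum_kernelFun_zero {k : ℕ} {p : Fin k → ℕ} (hp : ∀ i, 1 ≤ p i) {q M B : ℕ}
    (hB : ∑ i, p i + q ≤ B) :
    tailSum B ((kernelFun p q M).2 0) =
      ∑ m ∈ Icc 2 (∑ i, p i + q), halfLatticeSum m * PowerSeries.coeff (∑ i, p i + q - m)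
        (∏ i, localSeries (p i) fun l => shiftHarm l M 0) := by
  rw [← tailSum_shift hB]
  congr 1
  rw [kernelFun, Prod.snd_mul, Pi.mul_apply, Prod.snd_prod, Finset.prod_apply,
    prod_congr rfl fun i _ => truncPolygamma_snd (hp i) (Nat.zero_le M),
    prod_mul_distrib, prod_pow_eq_pow_sum, map_prod]
  simp [simplePole]
  ring

/-! ### Values of the kernel at the half-integers -/

/-- The value of a truncated polygamma function at `n + 1/2`. -/
noncomputable def posValue (s M n : ℕ) : ℝ :=
  ∑ j ∈ range (M + 1), ((n : ℝ) + 1 / 2 - j)⁻¹ ^ s + regConst s M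

/-- The value of a truncated polygamma function at `-(n + 1/2)`. -/
noncomputable def negValue (s M n : ℕ) : ℝ :=
  (-1) ^ s * ∑ j ∈ range (M + 1), ((n : ℝ) + 1 / 2 + j)⁻¹ ^ s + regConst s M

lemma kernelFun_fst_nat {k : ℕ} (p : Fin k → ℕ) (q M n : ℕ) :
    (kernelFun p q M).1 n = (∏ i, posValue (p i) M n) * ((n : ℝ) + 1 / 2)⁻¹ ^ q := by
  rw [mul_comm]
  simp [kernelFun, truncPolygamma, simplePole, posValue, constFun_fst, Prod.fst_prod, Prod.fst_sum]

lemma kernelFun_fst_neg {k : ℕ} (p : Fin k → ℕ) (q M n : ℕ) :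
    (kernelFun p q M).1 (-(n + 1)) =
      (-1) ^ q * (∏ i, negValue (p i) M n) * ((n : ℝ) + 1 / 2)⁻¹ ^ q := by
  have h (j : ℕ) (s : ℕ) : (((-(n + 1) : ℤ) : ℝ) + 1 / 2 - j)⁻¹ ^ s =
      (-1) ^ s * ((n : ℝ) + 1 / 2 + j)⁻¹ ^ s := by
    rw [← mul_pow]
    congr 1
    push_cast
    rw [show -((n : ℝ) + 1) + 1 / 2 - j = -(n + 1 / 2 + j) by ring, inv_neg]
    ring
  have h0 := h 0 q
  rw [Nat.cast_zero, sub_zero, add_zero] at h0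
  simp only [kernelFun, Prod.fst_mul, Prod.fst_prod, Pi.mul_apply, Finset.prod_apply,
    truncPolygamma, Prod.fst_add, Prod.fst_sum, Pi.add_apply, Finset.sum_apply, Prod.pow_fst,
    Pi.pow_apply, simplePole, h, constFun_fst, negValue, mul_sum, Nat.cast_zero, sub_zero, h0]
  ring

/-! ### The limit of the residue identity -/

/-- The constant part `lim ((-1)^s h_N^{(s)} + [s = 1] H_N)` of the polygamma function at the
half-integers. -/
noncomputable def halfConst (s : ℕ) : ℝ :=
  if s = 1 then -(2 * Real.log 2) else (-1) ^ s * ∑' n : ℕ, ((n : ℝ) + 1 / 2)⁻¹ ^ s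

/-- The constant part `lim ((-1)^s H_N^{(s)} + [s = 1] H_N)` of the polygamma function at the
integers. -/
noncomputable def zetaConst (s : ℕ) : ℝ :=
  if s = 1 then 0 else (-1) ^ s * ∑' n : ℕ, ((n : ℝ) + 1)⁻¹ ^ s

lemma tendsto_halfConst {s : ℕ} (hs : 1 ≤ s) :
    Tendsto (fun N => (-1) ^ s * genHarm (1 / 2) s N + regConst s N) atTop (𝓝 (halfConst s)) := by
  rcases hs.eq_or_lt with rfl | h2
  · rw [halfConst, if_pos rfl]
    refine tendsto_genHarm_sub.neg.congr fun N => ?_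
    rw [regConst, if_pos rfl]
    ring
  · have hne : s ≠ 1 := by omega
    simp only [halfConst, regConst, if_neg hne, add_zero]
    exact (tendsto_genHarm (by norm_num) h2).const_mul _

lemma tendsto_zetaConst {s : ℕ} (hs : 1 ≤ s) :
    Tendsto (fun N => (-1) ^ s * genHarm 1 s N + regConst s N) atTop (𝓝 (zetaConst s)) := by
  rcases hs.eq_or_lt with rfl | h2
  · rw [zetaConst, if_pos rfl]
    refine tendsto_const_nhds.congr fun N => ?_
    rw [regConst, if_pos rfl]
    ring
  · have hne : s ≠ 1 := by omega
    simp only [zetaConst, regConst, if_neg hne, add_zero]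
    exact (tendsto_genHarm one_pos h2).const_mul _

lemma tendsto_genHarm_shift (θ : ℝ) {s : ℕ} (hs : 1 ≤ s) (n : ℕ) :
    Tendsto (fun N => genHarm θ s (N + n) - genHarm θ s N) atTop (𝓝 0) := by
  have h (j : ℕ) : Tendsto (fun N : ℕ => ((N + j : ℝ) + θ)⁻¹ ^ s) atTop (𝓝 0) := by
    have h1 : Tendsto (fun N : ℕ => ((N : ℝ) + (j + θ))) atTop atTop :=
      tendsto_atTop_add_const_right _ _ tendsto_natCast_atTop_atTop
    have h2 := (tendsto_inv_atTop_zero.comp h1).pow s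
    rw [zero_pow (by omega)] at h2
    simpa [Function.comp_def, add_assoc] using h2
  have h3 := tendsto_finsetSum (range n) fun j _ => h j
  rw [sum_const_zero] at h3
  refine h3.congr fun N => ?_
  rw [genHarm_add]
  ring

lemma tendsto_regConst_shift (s n : ℕ) :
    Tendsto (fun N => regConst s (N + n) - regConst s N) atTop (𝓝 0) := by
  unfold regConst
  split_ifs
  · exact tendsto_genHarm_shift 1 le_rfl n
  · simp

lemma regConst_nonneg (s M : ℕ) : 0 ≤ regConst s M := by
  unfold regConst
  split_ifs
  exacts [genHarm_nonneg one_pos _ _, le_rfl]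

lemma regConst_le (s M : ℕ) : regConst s M ≤ genHarm 1 1 M := by
  unfold regConst
  split_ifs
  exacts [le_rfl, genHarm_nonneg one_pos _ _]

lemma regConst_add_le (s m n : ℕ) : regConst s (m + n) ≤ regConst s m + genHarm 1 1 n := by
  unfold regConst
  split_ifs
  · exact genHarm_add_le one_pos _ _ _
  · simpa using genHarm_nonneg one_pos _ _

lemma regConst_mono (s : ℕ) : Monotone (regConst s) := by
  intro m n h
  unfold regConst
  split_ifs
  exacts [genHarm_mono one_pos 1 h, le_rfl]

lemma Tame.of_genHarm_bound {u : ℕ → ℕ → ℝ} {v : ℕ → ℝ} {θ : ℝ} (hθ : 0 < θ) {s : ℕ} (hs : 1 ≤ s)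
    {K : ℝ} (hK : 0 ≤ K)
    (hb : ∀ M n, |u M n| ≤ K + 2 * genHarm θ s (n + 1) + genHarm 1 1 (n + 1))
    (ht : ∀ n, Tendsto (fun M => u M n) atTop (𝓝 (v n))) : Tame u v := by
  obtain ⟨C, hC, h1⟩ := exists_genHarm_le hθ hs
  obtain ⟨D, hD, h2⟩ := exists_genHarm_le one_pos (le_refl 1)
  refine ⟨⟨K + 2 * C + D, 1, by positivity, fun M n => ?_⟩, ht⟩
  have h3 := one_le_logScale n
  have h4 : K ≤ K * logScale n := le_mul_of_one_le_right hK h3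
  rw [pow_one]
  linarith [hb M n, h1 n, h2 n]

lemma exists_bound_of_tendsto {c : ℕ → ℝ} {x : ℝ} (h : Tendsto c atTop (𝓝 x)) :
    ∃ K, 0 ≤ K ∧ ∀ N, |c N| ≤ K := by
  obtain ⟨K, hK⟩ := h.abs.bddAbove_range
  exact ⟨K, (abs_nonneg (c 0)).trans (hK ⟨0, rfl⟩), fun N => hK ⟨N, rfl⟩⟩

lemma posValue_add (s n d : ℕ) : posValue s (d + n) n =
    genHarm (1 / 2) s (n + 1) + (-1) ^ s * genHarm (1 / 2) s d + regConst s (d + n) := by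
  rw [posValue, show d + n + 1 = (n + 1) + d by ring, sum_range_add]
  congr 2
  · rw [genHarm, ← sum_range_reflect]
    refine sum_congr rfl fun j hj => ?_
    have hj' : j < n + 1 := mem_range.1 hj
    congr 2
    rw [show n + 1 - 1 - j = n - j by omega, Nat.cast_sub (by omega)]
    ring
  · rw [genHarm, mul_sum]
    refine sum_congr rfl fun j _ => ?_
    rw [← mul_pow]
    congr 1
    push_cast
    rw [show (n : ℝ) + 1 / 2 - (n + 1 + j) = -(j + 1 / 2) by ring, inv_neg]
    ring

lemma posValue_of_lt {s n M : ℕ} (h : M < n) : posValue s M n =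
    genHarm (1 / 2) s (n + 1) - genHarm (1 / 2) s (n - M) + regConst s M := by
  obtain ⟨d, rfl⟩ := Nat.exists_eq_add_of_le h.le
  rw [posValue, Nat.add_sub_cancel_left, show M + d + 1 = d + (M + 1) by ring, genHarm_add,
    add_sub_cancel_left, ← sum_range_reflect]
  congr 1
  refine sum_congr rfl fun j hj => ?_
  have hj' : j < M + 1 := mem_range.1 hj
  congr 2
  rw [show M + 1 - 1 - j = M - j by omega, Nat.cast_sub (by omega)]
  push_cast
  ring

lemma negValue_eq (s M n : ℕ) : negValue s M n =
    (-1) ^ s * (genHarm (1 / 2) s (n + (M + 1)) - genHarm (1 / 2) s n) + regConst s M := by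
  rw [negValue, genHarm_add, add_sub_cancel_left]
  congr 2
  exact sum_congr rfl fun j _ => by congr 2; ring

lemma tame_posValue {s : ℕ} (hs : 1 ≤ s) :
    Tame (posValue s) fun n => genHarm (1 / 2) s (n + 1) + halfConst s := by
  have h2 : (0 : ℝ) < 1 / 2 := by norm_num
  obtain ⟨K, hK, hb⟩ := exists_bound_of_tendsto (tendsto_halfConst hs)
  refine Tame.of_genHarm_bound h2 hs hK (fun M n => ?_) fun n => ?_
  · have e1 := genHarm_nonneg h2 s (n + 1)
    have e2 := genHarm_mono one_pos 1 (Nat.le_succ n)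
    -- For `n > M` all poles lie to the left of `n + 1/2`, and no cancellation with the
    -- regularizing constant is needed.
    rcases lt_or_ge M n with h | h
    · rw [posValue_of_lt h]
      have e3 := genHarm_nonneg h2 s (n - M)
      have e4 : genHarm (1 / 2) s (n - M) ≤ genHarm (1 / 2) s (n + 1) :=
        genHarm_mono h2 s (by omega)
      have e5 := regConst_nonneg s M
      have e6 := regConst_le s M
      have e7 := genHarm_mono one_pos 1 h.le
      rw [abs_le]
      constructor <;> linarith
    · obtain ⟨d, rfl⟩ := Nat.exists_eq_add_of_le' h
      rw [posValue_add]
      have e3 := abs_le.1 (hb d)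
      have e4 := regConst_add_le s d n
      have e5 := regConst_mono s (Nat.le_add_right d n)
      rw [abs_le]
      constructor <;> linarith [e3.1, e3.2]
  · rw [← tendsto_add_atTop_iff_nat n]
    have := ((tendsto_halfConst hs).add (tendsto_regConst_shift s n)).const_add
      (genHarm (1 / 2) s (n + 1))
    rw [add_zero] at this
    refine this.congr fun N => ?_
    rw [posValue_add]
    ring

lemma tame_negValue {s : ℕ} (hs : 1 ≤ s) :
    Tame (negValue s) fun n => halfConst s - (-1) ^ s * genHarm (1 / 2) s n := by
  have h2 : (0 : ℝ) < 1 / 2 := by norm_num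
  obtain ⟨K, hK, hb⟩ := exists_bound_of_tendsto (tendsto_halfConst hs)
  refine Tame.of_genHarm_bound h2 hs hK (fun M n => ?_) fun n => ?_
  · have e1 := genHarm_nonneg h2 s (n + 1)
    have e2 := genHarm_mono h2 s (Nat.le_succ n)
    have e3 := genHarm_nonneg h2 s n
    have e4 := genHarm_add_le h2 s M (n + 1)
    have e5 : genHarm (1 / 2) s M ≤ genHarm (1 / 2) s (M + (n + 1)) :=
      genHarm_mono h2 s (by omega)
    have e6 := genHarm_nonneg one_pos 1 (n + 1)
    have e7 := abs_le.1 (hb M)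
    rw [negValue_eq, show n + (M + 1) = M + (n + 1) by ring, abs_le]
    rcases neg_one_pow_eq_or ℝ s with h | h <;> rw [h] at e7 ⊢ <;>
      constructor <;> linarith [e7.1, e7.2]
  · have := ((tendsto_halfConst hs).add
      ((tendsto_genHarm_shift (1 / 2) hs (n + 1)).const_mul ((-1) ^ s))).sub_const
        ((-1) ^ s * genHarm (1 / 2) s n)
    rw [mul_zero, add_zero] at this
    refine this.congr fun N => ?_
    rw [negValue_eq, show n + (N + 1) = N + (n + 1) by ring]
    ring

lemma tendsto_shiftHarm {s : ℕ} (hs : 1 ≤ s) (a : ℕ) :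
    Tendsto (fun M => shiftHarm s M a) atTop (𝓝 (genHarm 1 s a + zetaConst s)) := by
  rw [← tendsto_add_atTop_iff_nat a]
  have := ((tendsto_zetaConst hs).add (tendsto_regConst_shift s a)).const_add (genHarm 1 s a)
  rw [add_zero] at this
  refine this.congr fun N => ?_
  rw [shiftHarm, Nat.add_sub_cancel]
  ring

lemma tame_shiftHarm {s : ℕ} (hs : 1 ≤ s) :
    Tame (fun M n => shiftHarm s M (n + 1)) fun n => genHarm 1 s (n + 1) + zetaConst s := by
  obtain ⟨K, hK, hb⟩ := exists_bound_of_tendsto (tendsto_zetaConst hs)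
  refine Tame.of_genHarm_bound one_pos hs hK (fun M n => ?_) fun n => tendsto_shiftHarm hs _
  have e1 := genHarm_nonneg one_pos s (n + 1)
  rw [shiftHarm]
  -- For `M ≤ n + 1` the regularizing constant is itself at most `H_{n+1}`.
  rcases le_total M (n + 1) with h | h
  · rw [Nat.sub_eq_zero_of_le h, genHarm_zero, mul_zero, add_zero]
    have e5 := regConst_nonneg s M
    have e6 := regConst_le s M
    have e7 := genHarm_mono one_pos 1 h
    rw [abs_le]
    constructor <;> linarith
  · obtain ⟨d, rfl⟩ := Nat.exists_eq_add_of_le' h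
    rw [Nat.add_sub_cancel]
    have e3 := abs_le.1 (hb d)
    have e4 := regConst_add_le s d (n + 1)
    have e5 := regConst_mono s (Nat.le_add_right d (n + 1))
    rw [abs_le]
    constructor <;> linarith [e3.1, e3.2]

/-- The cutoff `n < M`, which turns the finite sum over the poles into a series with summand
depending on `M`. -/
lemma tame_indicator : Tame (fun M n => if n < M then 1 else 0) fun _ => 1 := by
  refine ⟨⟨1, 0, zero_le_one, fun M n => ?_⟩, fun n => ?_⟩
  · rw [pow_zero, mul_one]
    dsimp only
    split_ifs <;> simp
  · refine tendsto_const_nhds.congr' ?_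
    filter_upwards [eventually_gt_atTop n] with M hM
    rw [if_pos hM]

lemma tame_coeff_localSeries {s : ℕ} (hs : 1 ≤ s) (l : ℕ) :
    Tame (fun M n => PowerSeries.coeff l (localSeries s fun t => shiftHarm t M (n + 1)))
      fun n => PowerSeries.coeff l (localSeries s fun t => genHarm 1 t (n + 1) + zetaConst t) := by
  simp only [localSeries, PowerSeries.coeff_mk]
  split_ifs with h1 h2
  · exact .const 1
  · exact .const 0
  · exact (Tame.const _).mul (tame_shiftHarm (by omega))

lemma tame_coeff_prod_localSeries {k : ℕ} {p : Fin k → ℕ} (hp : ∀ i, 1 ≤ p i) (l : ℕ) :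
    Tame (fun M n => PowerSeries.coeff l
        (∏ i, localSeries (p i) fun t => shiftHarm t M (n + 1)))
      fun n => PowerSeries.coeff l
        (∏ i, localSeries (p i) fun t => genHarm 1 t (n + 1) + zetaConst t) := by
  simp only [PowerSeries.coeff_prod]
  exact Tame.sum _ fun e _ => Tame.prod _ fun i _ => tame_coeff_localSeries (hp i) _

lemma tendsto_coeff_prod_localSeries_zero {k : ℕ} {p : Fin k → ℕ} (hp : ∀ i, 1 ≤ p i) (l : ℕ) :
    Tendsto (fun M => PowerSeries.coeff l (∏ i, localSeries (p i) fun t => shiftHarm t M 0)) atTop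
      (𝓝 (PowerSeries.coeff l (∏ i, localSeries (p i) zetaConst))) := by
  simp only [PowerSeries.coeff_prod]
  refine tendsto_finsetSum _ fun e _ => tendsto_finsetProd _ fun i _ => ?_
  simp only [localSeries, PowerSeries.coeff_mk]
  have := hp i
  split_ifs with h1 h2
  · exact tendsto_const_nhds
  · exact tendsto_const_nhds
  · have h := (tendsto_shiftHarm (show 1 ≤ e i by omega) 0).const_mul
      ((invPowCoeff (p i) (e i - p i) : ℚ) : ℝ)
    rwa [genHarm_zero, zero_add] at h

/-- The partial fraction identity for the truncated kernel, summed over the half-integers. -/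
lemma tsum_kernel_trunc {k : ℕ} {p : Fin k → ℕ} (hp : ∀ i, 1 ≤ p i) {q : ℕ} (hq : 2 ≤ q) (M : ℕ) :
    ∑' n : ℕ, (∏ i, posValue (p i) M n + (-1) ^ q * ∏ i, negValue (p i) M n) *
        ((n : ℝ) + 1 / 2)⁻¹ ^ q =
      ∑ m ∈ Icc 2 (∑ i, p i + q), halfLatticeSum m * PowerSeries.coeff (∑ i, p i + q - m)
        (∏ i, localSeries (p i) fun l => shiftHarm l M 0) +
      ∑ n ∈ range M, ∑ m ∈ Icc 2 (∑ i, p i), halfLatticeSum m * PowerSeries.coeff (∑ i, p i - m)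
        (invLinear ((n : ℝ) + 1) ^ q * ∏ i, localSeries (p i) fun l => shiftHarm l M (n + 1)) := by
  have htame := (Tame.prod univ fun i _ => tame_posValue (hp i)).add
    ((Tame.const ((-1) ^ q)).mul (Tame.prod univ fun i _ => tame_negValue (hp i)))
  have hsum := (htame.summable (by norm_num : (0 : ℝ) < 1 / 2) hq M).hasSum.tendsto_sum_nat
  obtain ⟨B, hlim, hB⟩ := ((tendsto_sum_of_mem_poleSpan
    (kernelFun_mem_poleSpan hp (by omega : 1 ≤ q) M)).and
      (eventually_ge_atTop (∑ i, p i + q))).exists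
  -- The pole at `0` has the extra factor `x ^ (-q)` and is split off.
  rw [sum_range_succ', add_comm, tailSum_kernelFun_zero hp hB,
    sum_congr rfl fun n hn =>
      tailSum_kernelFun_succ hp (mem_range.1 hn) (by omega : ∑ i, p i ≤ B)] at hlim
  refine tendsto_nhds_unique (hsum.congr fun N => sum_congr rfl fun n _ => ?_) hlim
  rw [kernelFun_fst_nat, kernelFun_fst_neg]
  ring

/-- The residue identity: the sum over the half-integers of `x ^ (-q) ∏ᵢ ψ_{p i}(x)`, where `ψ_s`
is the polygamma function with poles at the natural numbers, in terms of its expansions there. -/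
theorem tsum_kernel {k : ℕ} {p : Fin k → ℕ} (hp : ∀ i, 1 ≤ p i) {q : ℕ} (hq : 2 ≤ q) :
    ∑' n : ℕ, (∏ i, (genHarm (1 / 2) (p i) (n + 1) + halfConst (p i)) +
        (-1) ^ q * ∏ i, (halfConst (p i) - (-1) ^ p i * genHarm (1 / 2) (p i) n)) *
        ((n : ℝ) + 1 / 2)⁻¹ ^ q =
      ∑ m ∈ Icc 2 (∑ i, p i + q), halfLatticeSum m * PowerSeries.coeff (∑ i, p i + q - m)
        (∏ i, localSeries (p i) zetaConst) +
      ∑ m ∈ Icc 2 (∑ i, p i), halfLatticeSum m * ∑ e ∈ antidiagonal (∑ i, p i - m),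
        (invPowCoeff q e.1 : ℝ) * ∑' n : ℕ, PowerSeries.coeff e.2
          (∏ i, localSeries (p i) fun l => genHarm 1 l (n + 1) + zetaConst l) *
            ((n : ℝ) + 1)⁻¹ ^ (q + e.1) := by
  have htame := (Tame.prod univ fun i _ => tame_posValue (hp i)).add
    ((Tame.const ((-1) ^ q)).mul (Tame.prod univ fun i _ => tame_negValue (hp i)))
  have hL := htame.tendsto_tsum (by norm_num : (0 : ℝ) < 1 / 2) hq
  have hterm (e : ℕ × ℕ) := (tame_indicator.mul (tame_coeff_prod_localSeries hp e.2)).tendsto_tsum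
    one_pos (show 2 ≤ q + e.1 by omega)
  have hR := (tendsto_finsetSum (Icc 2 (∑ i, p i + q)) fun m _ =>
    (tendsto_coeff_prod_localSeries_zero hp (∑ i, p i + q - m)).const_mul (halfLatticeSum m)).add
    (tendsto_finsetSum (Icc 2 (∑ i, p i)) fun m _ => (tendsto_finsetSum
      (antidiagonal (∑ i, p i - m)) fun e _ =>
        (hterm e).const_mul (invPowCoeff q e.1 : ℝ)).const_mul (halfLatticeSum m))
  simp only [one_mul] at hR
  refine tendsto_nhds_unique hL (hR.congr fun M => ?_)
  rw [tsum_kernel_trunc hp hq, sum_comm]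
  congr 1
  refine sum_congr rfl fun m _ => ?_
  rw [← mul_sum]
  congr 1
  simp only [PowerSeries.coeff_mul, coeff_invLinear_pow]
  rw [sum_comm]
  refine sum_congr rfl fun e _ => ?_
  rw [tsum_eq_sum (s := range M) fun n hn => by simp [show ¬ n < M by simpa using hn], mul_sum]
  refine sum_congr rfl fun n hn => ?_
  rw [if_pos (mem_range.1 hn)]
  ring

/-! ### Sequences graded by the number of harmonic factors -/

/-- The `A`-module of sequences spanned by the products of at most `d` shifted harmonic sums and a
power of `(n + θ)⁻¹`. -/
noncomputable def degSpan (A : Subalgebra ℚ ℝ) (θ : ℝ) (d : ℕ) : Submodule A (ℕ → ℝ) :=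
  Submodule.span A {u | ∃ (l : List ℕ) (c : ℕ), l.length ≤ d ∧ (∀ s ∈ l, 1 ≤ s) ∧
    u = fun n => (l.map fun s => genHarm θ s n).prod * ((n : ℝ) + θ)⁻¹ ^ c}

section degSpan

variable {A : Subalgebra ℚ ℝ} {θ : ℝ}

lemma degSpan_mono {d e : ℕ} (h : d ≤ e) : degSpan A θ d ≤ degSpan A θ e :=
  Submodule.span_mono fun _ ⟨l, c, hl, hs, hu⟩ => ⟨l, c, hl.trans h, hs, hu⟩

lemma inv_pow_mem_degSpan (c : ℕ) : (fun n : ℕ => ((n : ℝ) + θ)⁻¹ ^ c) ∈ degSpan A θ 0 :=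
  Submodule.subset_span ⟨[], c, le_rfl, by simp, by simp⟩

lemma const_mem_degSpan {x : ℝ} (hx : x ∈ A) : (fun _ => x) ∈ degSpan A θ 0 := by
  have h := (degSpan A θ 0).smul_mem (⟨x, hx⟩ : A) (inv_pow_mem_degSpan 0)
  convert h using 1
  funext n
  simp [Subalgebra.smul_def]

lemma genHarm_mem_degSpan {s : ℕ} (hs : 1 ≤ s) : genHarm θ s ∈ degSpan A θ 1 :=
  Submodule.subset_span ⟨[s], 0, le_rfl, by simpa using hs, by simp⟩

lemma genHarm_succ_mem_degSpan {s : ℕ} (hs : 1 ≤ s) :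
    (fun n => genHarm θ s (n + 1)) ∈ degSpan A θ 1 := by
  simp only [genHarm_succ]
  exact add_mem (genHarm_mem_degSpan hs) (degSpan_mono zero_le_one (inv_pow_mem_degSpan s))

lemma mul_mem_degSpan {d e : ℕ} {u v : ℕ → ℝ} (hu : u ∈ degSpan A θ d) (hv : v ∈ degSpan A θ e) :
    (fun n => u n * v n) ∈ degSpan A θ (d + e) := by
  change u * v ∈ _
  induction hu using Submodule.span_induction with
  | mem u h =>
    induction hv using Submodule.span_induction with
    | mem v h' =>
      obtain ⟨l, c, hl, hs, rfl⟩ := h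
      obtain ⟨l', c', hl', hs', rfl⟩ := h'
      refine Submodule.subset_span ⟨l ++ l', c + c', ?_, ?_, ?_⟩
      · rw [List.length_append]; omega
      · intro s h
        rcases List.mem_append.1 h with h | h
        exacts [hs s h, hs' s h]
      · funext n
        simp only [Pi.mul_apply, List.map_append, List.prod_append, pow_add]
        ring
    | zero => rw [mul_zero]; exact zero_mem _
    | add v w _ _ hv hw => rw [mul_add]; exact add_mem hv hw
    | smul a v _ hv => rw [mul_smul_comm]; exact Submodule.smul_mem _ _ hv
  | zero => rw [zero_mul]; exact zero_mem _
  | add v w _ _ hv hw => rw [add_mul]; exact add_mem hv hw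
  | smul a v _ hv => rw [smul_mul_assoc]; exact Submodule.smul_mem _ _ hv

lemma const_mul_mem_degSpan {d : ℕ} {x : ℝ} (hx : x ∈ A) {u : ℕ → ℝ} (hu : u ∈ degSpan A θ d) :
    (fun n => x * u n) ∈ degSpan A θ d :=
  (degSpan A θ d).smul_mem (⟨x, hx⟩ : A) hu

lemma prod_mem_degSpan {ι : Type*} (t : Finset ι) {f : ι → ℕ → ℝ} {d : ι → ℕ}
    (h : ∀ i ∈ t, f i ∈ degSpan A θ (d i)) :
    (fun n => ∏ i ∈ t, f i n) ∈ degSpan A θ (∑ i ∈ t, d i) := by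
  classical
  induction t using Finset.induction_on with
  | empty => simpa using const_mem_degSpan (one_mem A)
  | insert i t hi ih =>
    simp only [prod_insert hi, sum_insert hi]
    exact mul_mem_degSpan (h i (mem_insert_self _ _)) (ih fun j hj => h j (mem_insert_of_mem hj))

/-- Perturbing every factor by terms of degree `0` changes a product of factors of degree `1` by
terms of lower degree only. -/
lemma prod_add_sub_prod_mem_degSpan {k : ℕ} {f g : Fin k → ℕ → ℝ}
    (hf : ∀ i, f i ∈ degSpan A θ 1) (hg : ∀ i, g i ∈ degSpan A θ 0) :
    (fun n => ∏ i, (f i n + g i n) - ∏ i, f i n) ∈ degSpan A θ (k - 1) := by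
  classical
  have h : (fun n => ∏ i, (f i n + g i n) - ∏ i, f i n) =
      ∑ t ∈ (univ : Finset (Fin k)).powerset.erase univ,
        fun n => (∏ i ∈ t, f i n) * ∏ i ∈ univ \ t, g i n := by
    funext n
    rw [prod_add, ← add_sum_erase _ _ (mem_powerset_self univ), Finset.sum_apply]
    simp
  rw [h]
  refine sum_mem fun t ht => ?_
  have ht' : t.card < k := by
    simpa using (card_lt_iff_ne_univ t).2 (ne_of_mem_erase ht)
  have h1 := mul_mem_degSpan (prod_mem_degSpan t fun i _ => hf i)
    (prod_mem_degSpan (univ \ t) fun i _ => hg i)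
  refine degSpan_mono ?_ h1
  simp
  omega

lemma tame_of_mem_degSpan (hθ : 0 < θ) {d : ℕ} {u : ℕ → ℝ} (hu : u ∈ degSpan A θ d) :
    Tame (fun _ => u) u := by
  induction hu using Submodule.span_induction with
  | mem u h =>
    obtain ⟨l, c, -, hs, rfl⟩ := h
    refine Tame.mul (u := fun _ n => _) ?_ ?_
    · clear * - hs hθ
      induction l with
      | nil => simpa using Tame.const 1
      | cons s l ih =>
        simp only [List.map_cons, List.prod_cons]
        exact (tame_genHarm hθ (hs s (by simp))).mul (ih fun t ht => hs t (by simp [ht]))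
    · refine ⟨⟨θ⁻¹ ^ c, 0, by positivity, fun _ n => ?_⟩, fun n => tendsto_const_nhds⟩
      rw [abs_of_nonneg (by positivity), pow_zero, mul_one]
      have : θ ≤ n + θ := by linarith [(Nat.cast_nonneg n : (0 : ℝ) ≤ n)]
      exact pow_le_pow_left₀ (by positivity) (inv_anti₀ hθ this) c
  | zero => exact Tame.const 0
  | add u v _ _ hu hv => exact hu.add hv
  | smul a u _ hu => exact (Tame.const (a : ℝ)).mul hu

/-- Membership of the series `∑ u n / (n + θ) ^ q` in `A` only has to be checked on products of
harmonic sums. -/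
lemma tsum_mem_of_mem_degSpan (hθ : 0 < θ) {d : ℕ}
    (hA : ∀ (l : List ℕ) (q : ℕ), l.length ≤ d → (∀ s ∈ l, 1 ≤ s) → 2 ≤ q →
      ∑' n : ℕ, (l.map fun s => genHarm θ s n).prod * ((n : ℝ) + θ)⁻¹ ^ q ∈ A)
    {u : ℕ → ℝ} (hu : u ∈ degSpan A θ d) {q : ℕ} (hq : 2 ≤ q) :
    ∑' n : ℕ, u n * ((n : ℝ) + θ)⁻¹ ^ q ∈ A := by
  induction hu using Submodule.span_induction with
  | mem u h =>
    obtain ⟨l, c, hl, hs, rfl⟩ := h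
    simpa only [mul_assoc, ← pow_add] using hA l (c + q) hl hs (by omega)
  | zero => simp
  | add u v hu hv ihu ihv =>
    have h1 := (tame_of_mem_degSpan hθ hu).summable hθ hq 0
    have h2 := (tame_of_mem_degSpan hθ hv).summable hθ hq 0
    simp only [Pi.add_apply, add_mul]
    rw [h1.tsum_add h2]
    exact add_mem ihu ihv
  | smul a u _ ih =>
    simp only [Pi.smul_apply, Subalgebra.smul_def, smul_eq_mul, mul_assoc]
    rw [tsum_mul_left]
    exact mul_mem a.2 ih

end degSpan

/-! ### Products of harmonic numbers as multiple zeta values -/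

/-- The weighted summation operator `u ↦ ∑_{m < n} u m / (m + 1) ^ s`. -/
noncomputable def weightedSum (s : ℕ) : (ℕ → ℝ) →ₗ[ℚ] (ℕ → ℝ) where
  toFun u n := ∑ m ∈ range n, ((m : ℝ) + 1)⁻¹ ^ s * u m
  map_add' u v := by funext n; simp [mul_add, sum_add_distrib]
  map_smul' a u := by
    funext n
    simp only [Pi.smul_apply, smul_sum, mul_smul_comm, RingHom.id_apply]

lemma weightedSum_apply (s : ℕ) (u : ℕ → ℝ) (n : ℕ) :
    weightedSum s u n = ∑ m ∈ range n, ((m : ℝ) + 1)⁻¹ ^ s * u m := rfl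

/-- Truncated multiple zeta values, with indices at most `n`. -/
noncomputable def mzvPartial (l : List ℕ) (n : ℕ) : ℝ := mzvTrunc l (n + 1)

lemma mzvPartial_nil : mzvPartial [] = 1 := by
  funext n; simp [mzvPartial, mzvTrunc]

lemma mzvPartial_cons (s : ℕ) (l : List ℕ) :
    mzvPartial (s :: l) = weightedSum s (mzvPartial l) := by
  funext n
  rw [mzvPartial, mzvTrunc, weightedSum_apply, sum_Ico_eq_sum_range]
  refine sum_congr rfl fun m _ => ?_
  rw [mzvPartial, add_comm 1 m]
  push_cast
  simp

lemma genHarm_one_eq_weightedSum (s : ℕ) : genHarm 1 s = weightedSum s 1 := by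
  funext n; simp [genHarm, weightedSum_apply]

/-- The quasi-shuffle relation for nested sums. -/
lemma genHarm_mul_weightedSum (s t : ℕ) (u : ℕ → ℝ) :
    genHarm 1 s * weightedSum t u = weightedSum s (weightedSum t u) +
      weightedSum t (genHarm 1 s * u) + weightedSum (s + t) u := by
  funext n
  simp only [Pi.mul_apply, Pi.add_apply]
  induction n with
  | zero => simp [weightedSum_apply]
  | succ n ih =>
    have h (r : ℕ) (v : ℕ → ℝ) : weightedSum r v (n + 1) =
        weightedSum r v n + ((n : ℝ) + 1)⁻¹ ^ r * v n := by
      simp [weightedSum_apply, sum_range_succ]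
    rw [h, h, h, h, genHarm_succ, add_mul, mul_add, ih, Pi.mul_apply, pow_add]
    ring

/-- The rational span of the truncated multiple zeta values of depth at most `d`. -/
noncomputable def mzvSpan (d : ℕ) : Submodule ℚ (ℕ → ℝ) :=
  Submodule.span ℚ {u | ∃ l : List ℕ, l.length ≤ d ∧ (∀ s ∈ l, 1 ≤ s) ∧ u = mzvPartial l}

lemma mzvPartial_mem_mzvSpan {l : List ℕ} {d : ℕ} (hl : l.length ≤ d) (hs : ∀ s ∈ l, 1 ≤ s) :
    mzvPartial l ∈ mzvSpan d := Submodule.subset_span ⟨l, hl, hs, rfl⟩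

lemma weightedSum_mem_mzvSpan {t d : ℕ} (ht : 1 ≤ t) {u : ℕ → ℝ} (hu : u ∈ mzvSpan d) :
    weightedSum t u ∈ mzvSpan (d + 1) := by
  induction hu using Submodule.span_induction with
  | mem u h =>
    obtain ⟨l, hl, hs, rfl⟩ := h
    rw [← mzvPartial_cons]
    exact mzvPartial_mem_mzvSpan (by simpa using hl) (by simpa [ht] using hs)
  | zero => rw [map_zero]; exact zero_mem _
  | add u v _ _ hu hv => rw [map_add]; exact add_mem hu hv
  | smul a u _ hu => rw [map_smul]; exact Submodule.smul_mem _ _ hu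

lemma genHarm_mul_mzvPartial_mem {s : ℕ} (hs : 1 ≤ s) (l : List ℕ) (hl : ∀ t ∈ l, 1 ≤ t) :
    genHarm 1 s * mzvPartial l ∈ mzvSpan (l.length + 1) := by
  induction l with
  | nil =>
    rw [mzvPartial_nil, mul_one, genHarm_one_eq_weightedSum, ← mzvPartial_nil, ← mzvPartial_cons]
    exact mzvPartial_mem_mzvSpan le_rfl (by simpa using hs)
  | cons t l ih =>
    have ht : 1 ≤ t := hl t (by simp)
    have hl' : ∀ r ∈ l, 1 ≤ r := fun r hr => hl r (by simp [hr])
    rw [mzvPartial_cons, genHarm_mul_weightedSum, ← mzvPartial_cons t, ← mzvPartial_cons,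
      ← mzvPartial_cons]
    refine add_mem (add_mem ?_ (weightedSum_mem_mzvSpan ht (ih hl'))) ?_
    · exact mzvPartial_mem_mzvSpan (by simp) (by simpa [hs, ht] using hl')
    · exact mzvPartial_mem_mzvSpan (by simp)
        (by simp only [List.mem_cons, forall_eq_or_imp]; exact ⟨by omega, hl'⟩)

lemma prod_genHarm_mem_mzvSpan (l : List ℕ) (hl : ∀ s ∈ l, 1 ≤ s) :
    (fun n => (l.map fun s => genHarm 1 s n).prod) ∈ mzvSpan l.length := by
  induction l with
  | nil => simpa [mzvPartial_nil, Pi.one_def] using mzvPartial_mem_mzvSpan (l := []) (d := 0)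
  | cons s l ih =>
    have hs : 1 ≤ s := hl s (by simp)
    have ih' := ih fun r hr => hl r (by simp [hr])
    simp only [List.map_cons, List.prod_cons, List.length_cons]
    change genHarm 1 s * (fun n => (l.map fun s => genHarm 1 s n).prod) ∈ _
    generalize (fun n => (l.map fun s => genHarm 1 s n).prod) = u at ih'
    generalize l.length = d at ih'
    induction ih' using Submodule.span_induction with
    | mem u h =>
      obtain ⟨l, hl, hs', rfl⟩ := h
      refine Submodule.span_mono ?_ (genHarm_mul_mzvPartial_mem hs l hs')
      exact fun _ ⟨l', h1, h2, h3⟩ => ⟨l', by omega, h2, h3⟩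
    | zero => rw [mul_zero]; exact zero_mem _
    | add v w _ _ hv hw => rw [mul_add]; exact add_mem hv hw
    | smul a v _ hv => rw [mul_smul_comm]; exact Submodule.smul_mem _ _ hv

lemma logScale_mono : Monotone logScale := by
  intro m n h
  unfold logScale
  gcongr

lemma tame_mzvPartial (l : List ℕ) (hl : ∀ s ∈ l, 1 ≤ s) :
    Tame (fun _ => mzvPartial l) (mzvPartial l) := by
  induction l with
  | nil => rw [mzvPartial_nil]; exact Tame.const 1
  | cons s l ih =>
    obtain ⟨⟨C, d, hC, hb⟩, -⟩ := ih fun r hr => hl r (by simp [hr])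
    obtain ⟨D, hD, h2⟩ := exists_genHarm_le one_pos (hl s (by simp))
    refine ⟨⟨D * C, d + 1, by positivity, fun _ n => ?_⟩, fun n => tendsto_const_nhds⟩
    have h0 := fun m => zero_le_one.trans (one_le_logScale m)
    calc |mzvPartial (s :: l) n|
        ≤ ∑ m ∈ range n, |((m : ℝ) + 1)⁻¹ ^ s * mzvPartial l m| := by
          rw [mzvPartial_cons, weightedSum_apply]
          exact abs_sum_le_sum_abs _ _
      _ ≤ ∑ m ∈ range n, ((m : ℝ) + 1)⁻¹ ^ s * (C * logScale n ^ d) := by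
          refine sum_le_sum fun m hm => ?_
          rw [abs_mul, abs_of_nonneg (by positivity : 0 ≤ ((m : ℝ) + 1)⁻¹ ^ s)]
          refine mul_le_mul_of_nonneg_left ((hb 0 m).trans ?_) (by positivity)
          exact mul_le_mul_of_nonneg_left
            (pow_le_pow_left₀ (h0 m) (logScale_mono (mem_range.1 hm).le) d) hC
      _ = genHarm 1 s n * (C * logScale n ^ d) := by rw [genHarm, sum_mul]
      _ ≤ D * logScale n * (C * logScale n ^ d) := by
          have := h0 n
          refine mul_le_mul_of_nonneg_right ?_ (by positivity)
          exact (genHarm_mono one_pos s (Nat.le_succ n)).trans (h2 n)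
      _ = _ := by ring

lemma tame_of_mem_mzvSpan {d : ℕ} {u : ℕ → ℝ} (hu : u ∈ mzvSpan d) : Tame (fun _ => u) u := by
  induction hu using Submodule.span_induction with
  | mem u h =>
    obtain ⟨l, -, hs, rfl⟩ := h
    exact tame_mzvPartial l hs
  | zero => exact Tame.const 0
  | add u v _ _ hu hv => exact hu.add hv
  | smul a u _ hu =>
    convert (Tame.const (a : ℝ)).mul hu using 1 <;> ext <;> simp [Rat.smul_def]

lemma mzv_eq_tsum (q : ℕ) (l : List ℕ) :
    mzv q l = ∑' n : ℕ, mzvPartial l n * ((n : ℝ) + 1)⁻¹ ^ q := by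
  rw [mzv]
  refine tsum_congr fun n => ?_
  rw [mzvPartial, mul_comm, one_div, inv_pow]

lemma tsum_mem_of_mem_mzvSpan {A : Subalgebra ℚ ℝ} {k d : ℕ} (hZ : mzvsOfDepthLE k ⊆ A)
    (hd : d + 1 ≤ k) {u : ℕ → ℝ} (hu : u ∈ mzvSpan d) {q : ℕ} (hq : 2 ≤ q) :
    ∑' n : ℕ, u n * ((n : ℝ) + 1)⁻¹ ^ q ∈ A := by
  induction hu using Submodule.span_induction with
  | mem u h =>
    obtain ⟨l, hl, hs, rfl⟩ := h
    exact hZ ⟨q, l, hq, hs, by omega, (mzv_eq_tsum q l).symm⟩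
  | zero => simp
  | add u v hu hv ihu ihv =>
    have h1 := (tame_of_mem_mzvSpan hu).summable one_pos hq 0
    have h2 := (tame_of_mem_mzvSpan hv).summable one_pos hq 0
    simp only [Pi.add_apply, add_mul]
    rw [h1.tsum_add h2]
    exact add_mem ihu ihv
  | smul a u _ ih =>
    simp only [Pi.smul_apply, Rat.smul_def, mul_assoc]
    rw [tsum_mul_left]
    exact mul_mem (A.algebraMap_mem a) ih

/-! ### Zeta values at the half-integers -/

lemma tsum_half_inv_pow {s : ℕ} (hs : 2 ≤ s) :
    ∑' n : ℕ, ((n : ℝ) + 1 / 2)⁻¹ ^ s = (2 ^ s - 1) * ∑' n : ℕ, ((n : ℝ) + 1)⁻¹ ^ s := by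
  have h1 := (summable_inv_pow (θ := 1 / 2) (by norm_num) hs).mul_left ((2 : ℝ)⁻¹ ^ s)
  have h2 := (summable_inv_pow one_pos hs).mul_left ((2 : ℝ)⁻¹ ^ s)
  have e1 (n : ℕ) : (((2 * n : ℕ) : ℝ) + 1)⁻¹ ^ s = (2 : ℝ)⁻¹ ^ s * ((n : ℝ) + 1 / 2)⁻¹ ^ s := by
    rw [← mul_pow, ← mul_inv]
    congr 2
    push_cast; ring
  have e2 (n : ℕ) : (((2 * n + 1 : ℕ) : ℝ) + 1)⁻¹ ^ s = (2 : ℝ)⁻¹ ^ s * ((n : ℝ) + 1)⁻¹ ^ s := by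
    rw [← mul_pow, ← mul_inv]
    congr 2
    push_cast; ring
  -- Splitting the zeta series into even and odd denominators.
  have h := tsum_even_add_odd (f := fun n : ℕ => ((n : ℝ) + 1)⁻¹ ^ s)
    (by simpa only [e1] using h1) (by simpa only [e2] using h2)
  simp only [e1, e2, tsum_mul_left] at h
  have h2s : (2 : ℝ)⁻¹ ^ s * 2 ^ s = 1 := by rw [← mul_pow]; norm_num
  linear_combination (2 : ℝ) ^ s * h - (∑' n : ℕ, ((n : ℝ) + 1 / 2)⁻¹ ^ s +
    ∑' n : ℕ, ((n : ℝ) + 1)⁻¹ ^ s) * h2s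

/-! ### Membership in the algebra -/

section membership

variable {A : Subalgebra ℚ ℝ} {k : ℕ}

lemma tsum_inv_pow_mem (hk : 1 ≤ k) (hZ : mzvsOfDepthLE k ⊆ A) {s : ℕ} (hs : 2 ≤ s) :
    ∑' n : ℕ, ((n : ℝ) + 1)⁻¹ ^ s ∈ A := by
  have := hZ ⟨s, [], hs, by simp, by simpa using hk, rfl⟩
  simpa [mzv_eq_tsum, mzvPartial_nil] using this

lemma tsum_half_inv_pow_mem (hk : 1 ≤ k) (hZ : mzvsOfDepthLE k ⊆ A) {s : ℕ} (hs : 2 ≤ s) :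
    ∑' n : ℕ, ((n : ℝ) + 1 / 2)⁻¹ ^ s ∈ A := by
  rw [tsum_half_inv_pow hs]
  refine mul_mem (sub_mem (pow_mem ?_ s) (one_mem A)) (tsum_inv_pow_mem hk hZ hs)
  exact_mod_cast natCast_mem A 2

lemma neg_one_pow_mem (n : ℕ) : (-1 : ℝ) ^ n ∈ A := pow_mem (neg_mem (one_mem A)) n

lemma halfLatticeSum_mem (hk : 1 ≤ k) (hZ : mzvsOfDepthLE k ⊆ A) {s : ℕ} (hs : 2 ≤ s) :
    halfLatticeSum s ∈ A :=
  mul_mem (add_mem (one_mem A) (neg_one_pow_mem s)) (tsum_half_inv_pow_mem hk hZ hs)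

lemma zetaConst_mem (hk : 1 ≤ k) (hZ : mzvsOfDepthLE k ⊆ A) {s : ℕ} (hs : 1 ≤ s) :
    zetaConst s ∈ A := by
  unfold zetaConst
  split_ifs
  · exact zero_mem A
  · exact mul_mem (neg_one_pow_mem s) (tsum_inv_pow_mem hk hZ (by omega))

lemma halfConst_mem (hk : 1 ≤ k) (hlog : Real.log 2 ∈ A) (hZ : mzvsOfDepthLE k ⊆ A) {s : ℕ}
    (hs : 1 ≤ s) : halfConst s ∈ A := by
  unfold halfConst
  split_ifs
  · refine neg_mem (mul_mem ?_ hlog)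
    exact_mod_cast natCast_mem A 2
  · exact mul_mem (neg_one_pow_mem s) (tsum_half_inv_pow_mem hk hZ (by omega))

lemma ratCast_mem (x : ℚ) : (x : ℝ) ∈ A := A.algebraMap_mem x

lemma coeff_prod_localSeries_zetaConst_mem (hk : 1 ≤ k) (hZ : mzvsOfDepthLE k ⊆ A) {ι : Type*}
    [Fintype ι] {p : ι → ℕ} (hp : ∀ i, 1 ≤ p i) (l : ℕ) :
    PowerSeries.coeff l (∏ i, localSeries (p i) zetaConst) ∈ A := by
  classical
  rw [PowerSeries.coeff_prod]
  refine sum_mem fun e _ => prod_mem fun i _ => ?_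
  have := hp i
  rw [localSeries, PowerSeries.coeff_mk]
  split_ifs
  · exact one_mem A
  · exact zero_mem A
  · exact mul_mem (ratCast_mem _) (zetaConst_mem hk hZ (by omega))

/-- Below the index `∑ p i` at least one factor contributes no harmonic sum, since the
coefficients of `localSeries s` of index `< s` are constants. -/
lemma coeff_prod_localSeries_mem_degSpan (hk : 1 ≤ k) (hZ : mzvsOfDepthLE k ⊆ A) {p : Fin k → ℕ}
    (hp : ∀ i, 1 ≤ p i) {l : ℕ} (hl : l < ∑ i, p i) :
    (fun n => PowerSeries.coeff l
      (∏ i, localSeries (p i) fun t => genHarm 1 t (n + 1) + zetaConst t)) ∈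
        degSpan A 1 (k - 1) := by
  simp only [PowerSeries.coeff_prod]
  rw [show (fun n => ∑ e ∈ finsuppAntidiag univ l, ∏ i, PowerSeries.coeff (e i)
      (localSeries (p i) fun t => genHarm 1 t (n + 1) + zetaConst t)) =
    ∑ e ∈ finsuppAntidiag univ l, fun n => ∏ i, PowerSeries.coeff (e i)
      (localSeries (p i) fun t => genHarm 1 t (n + 1) + zetaConst t) by
    funext n; rw [Finset.sum_apply]]
  refine sum_mem fun e he => ?_
  have hfac (i : Fin k) : (fun n => PowerSeries.coeff (e i)
      (localSeries (p i) fun t => genHarm 1 t (n + 1) + zetaConst t)) ∈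
        degSpan A 1 (if e i < p i then 0 else 1) := by
    have := hp i
    simp only [localSeries, PowerSeries.coeff_mk]
    by_cases h1 : e i < p i
    · rw [if_pos h1]
      by_cases h2 : e i = 0
      · simpa only [if_pos h2] using const_mem_degSpan (one_mem A)
      · simpa only [if_neg h2, if_pos h1] using const_mem_degSpan (zero_mem A)
    · have h2 : e i ≠ 0 := by omega
      simp only [if_neg h1, if_neg h2]
      refine const_mul_mem_degSpan (ratCast_mem _) (add_mem ?_ ?_)
      · exact genHarm_succ_mem_degSpan (by omega)
      · exact degSpan_mono zero_le_one (const_mem_degSpan (zetaConst_mem hk hZ (by omega)))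
  refine degSpan_mono ?_ (prod_mem_degSpan univ fun i _ => hfac i)
  -- Some index `e i` lies below `p i`, since these indices add up to `l < ∑ p i`.
  obtain ⟨i, -, hi⟩ : ∃ i ∈ univ, e i < p i := by
    refine exists_lt_of_sum_lt ?_
    rwa [(mem_finsuppAntidiag.1 he).1]
  have : ∑ j, (if e j < p j then 0 else 1) < ∑ _j : Fin k, 1 :=
    sum_lt_sum (fun j _ => by split_ifs <;> simp) ⟨i, mem_univ i, by simp [hi]⟩
  simp at this ⊢
  omega

lemma tsum_mem_of_mem_degSpan_one (hk : 1 ≤ k) (hZ : mzvsOfDepthLE k ⊆ A) {u : ℕ → ℝ}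
    (hu : u ∈ degSpan A 1 (k - 1)) {q : ℕ} (hq : 2 ≤ q) :
    ∑' n : ℕ, u n * ((n : ℝ) + 1)⁻¹ ^ q ∈ A :=
  tsum_mem_of_mem_degSpan one_pos (fun l _ hl hs hq =>
    tsum_mem_of_mem_mzvSpan hZ (by omega) (prod_genHarm_mem_mzvSpan l hs) hq) hu hq

lemma eulerTTerm_eq {j : ℕ} (p : Fin j → ℕ) (q n : ℕ) :
    eulerTTerm p q n = (∏ i, genHarm (1 / 2) (p i) n) * ((n : ℝ) + 1 / 2)⁻¹ ^ q := by
  simp only [eulerTTerm, oddHarmonic_eq_genHarm, div_eq_mul_inv, inv_pow]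

lemma tsum_mem_of_mem_degSpan_half (hk : 1 ≤ k) (hZ : mzvsOfDepthLE k ⊆ A)
    (hT : eulerTSumsOfDegreeLE (k - 1) ⊆ A) {u : ℕ → ℝ}
    (hu : u ∈ degSpan A (1 / 2) (k - 1)) {q : ℕ} (hq : 2 ≤ q) :
    ∑' n : ℕ, u n * ((n : ℝ) + 1 / 2)⁻¹ ^ q ∈ A := by
  refine tsum_mem_of_mem_degSpan (by norm_num) (fun l q hl hs hq => ?_) hu hq
  rcases l with _ | ⟨s, l⟩
  · simpa using tsum_half_inv_pow_mem hk hZ hq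
  · refine hT ⟨_, fun i : Fin (s :: l).length => (s :: l)[i.1], q, by simp, hl, ?_, hq, ?_⟩
    · exact fun i => hs _ (List.getElem_mem _)
    · rw [eulerT]
      refine tsum_congr fun n => ?_
      rw [eulerTTerm_eq]
      congr 1
      exact (Fin.prod_univ_fun_getElem (s :: l) fun s => genHarm (1 / 2) s n).symm

end membership

/-! ### The parity theorem -/

theorem mainTheorem1 (k : ℕ) (hk : 2 ≤ k) (p : Fin k → ℕ) (q : ℕ)
    (hp : ∀ i, 1 ≤ p i) (hq : 2 ≤ q)
    (hparity : (∑ i, p i) + q ≡ k [MOD 2]) :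
    Summable (eulerTTerm p q) ∧
      eulerT p q ∈ Algebra.adjoin ℚ
        ({Real.log 2} ∪ eulerTSumsOfDegreeLE (k - 1) ∪ mzvsOfDepthLE k : Set ℝ) := by
  set A := Algebra.adjoin ℚ
    ({Real.log 2} ∪ eulerTSumsOfDegreeLE (k - 1) ∪ mzvsOfDepthLE k : Set ℝ)
  have hlog : Real.log 2 ∈ A := Algebra.subset_adjoin (by simp)
  have hT : eulerTSumsOfDegreeLE (k - 1) ⊆ A := fun x hx =>
    Algebra.subset_adjoin (.inl (.inr hx))
  have hZ : mzvsOfDepthLE k ⊆ A := fun x hx => Algebra.subset_adjoin (.inr hx)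
  have hk1 : 1 ≤ k := by omega
  have h2 : (0 : ℝ) < 1 / 2 := by norm_num
  have hharm (i : Fin k) : genHarm (1 / 2) (p i) ∈ degSpan A (1 / 2) 1 :=
    genHarm_mem_degSpan (hp i)
  have hconst (i : Fin k) : (fun _ => halfConst (p i)) ∈ degSpan A (1 / 2) 0 :=
    const_mem_degSpan (halfConst_mem hk1 hlog hZ (hp i))
  have hprod := Tame.prod univ fun i _ => tame_genHarm h2 (hp i)
  have hsumm := hprod.summable h2 hq 0
  have hterm : eulerTTerm p q =
      fun n : ℕ => (∏ i, genHarm (1 / 2) (p i) n) * ((n : ℝ) + 1 / 2)⁻¹ ^ q :=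
    funext fun n => eulerTTerm_eq p q n
  refine ⟨by rw [hterm]; exact hsumm, ?_⟩
  -- Both products in the residue identity are `± ∏ h_n` up to terms of lower degree.
  have hlow : (fun n : ℕ => (∏ i, (genHarm (1 / 2) (p i) n + (((n : ℝ) + 1 / 2)⁻¹ ^ p i +
        halfConst (p i))) - ∏ i, genHarm (1 / 2) (p i) n) + (-1) ^ q *
        (∏ i, (-(-1) ^ p i * genHarm (1 / 2) (p i) n + halfConst (p i)) -
          ∏ i, (-(-1) ^ p i * genHarm (1 / 2) (p i) n))) ∈ degSpan A (1 / 2) (k - 1) :=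
    add_mem
      (prod_add_sub_prod_mem_degSpan hharm
        fun i => add_mem (inv_pow_mem_degSpan (p i)) (hconst i))
      (const_mul_mem_degSpan (neg_one_pow_mem q) (prod_add_sub_prod_mem_degSpan
        (fun i => const_mul_mem_degSpan (neg_mem (neg_one_pow_mem (p i))) (hharm i)) hconst))
  have hlowsum := tsum_mem_of_mem_degSpan_half hk1 hZ hT hlow hq
  -- The parity condition makes the two leading terms equal.
  have hsign : (-1 : ℝ) ^ q * ∏ i, (-(-1 : ℝ) ^ p i) = 1 := by
    rw [prod_neg, prod_pow_eq_pow_sum, card_univ, Fintype.card_fin, ← pow_add, ← pow_add]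
    refine Even.neg_one_pow ?_
    rw [Nat.even_iff]
    have := hparity
    unfold Nat.ModEq at this
    omega
  have hres := tsum_kernel hp hq
  have hsplit (n : ℕ) : (∏ i, (genHarm (1 / 2) (p i) (n + 1) + halfConst (p i)) +
        (-1) ^ q * ∏ i, (halfConst (p i) - (-1) ^ p i * genHarm (1 / 2) (p i) n)) *
        ((n : ℝ) + 1 / 2)⁻¹ ^ q =
      2 * eulerTTerm p q n + ((∏ i, (genHarm (1 / 2) (p i) n + (((n : ℝ) + 1 / 2)⁻¹ ^ p i +
        halfConst (p i))) - ∏ i, genHarm (1 / 2) (p i) n) + (-1) ^ q *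
        (∏ i, (-(-1) ^ p i * genHarm (1 / 2) (p i) n + halfConst (p i)) -
          ∏ i, (-(-1) ^ p i * genHarm (1 / 2) (p i) n))) * ((n : ℝ) + 1 / 2)⁻¹ ^ q := by
    have e1 : ∏ i, (genHarm (1 / 2) (p i) (n + 1) + halfConst (p i)) =
        ∏ i, (genHarm (1 / 2) (p i) n + (((n : ℝ) + 1 / 2)⁻¹ ^ p i + halfConst (p i))) :=
      prod_congr rfl fun i _ => by rw [genHarm_succ]; ring
    have e2 : ∏ i, (halfConst (p i) - (-1) ^ p i * genHarm (1 / 2) (p i) n) =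
        ∏ i, (-(-1) ^ p i * genHarm (1 / 2) (p i) n + halfConst (p i)) :=
      prod_congr rfl fun i _ => by ring
    rw [e1, e2, eulerTTerm_eq, prod_mul_distrib (f := fun i => -(-1 : ℝ) ^ p i)]
    linear_combination ((∏ i, genHarm (1 / 2) (p i) n) * ((n : ℝ) + 1 / 2)⁻¹ ^ q) * hsign
  simp only [hsplit] at hres
  have hsT : Summable fun n => 2 * eulerTTerm p q n := by
    rw [hterm]; exact hsumm.mul_left 2
  rw [hsT.tsum_add ((tame_of_mem_degSpan h2 hlow).summable h2 hq 0), tsum_mul_left] at hres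
  have h2T : 2 * eulerT p q ∈ A := by
    rw [eulerT, eq_sub_of_add_eq hres]
    refine sub_mem (add_mem (sum_mem fun m hm => ?_) (sum_mem fun m hm => ?_)) hlowsum
    · exact mul_mem (halfLatticeSum_mem hk1 hZ (mem_Icc.1 hm).1)
        (coeff_prod_localSeries_zetaConst_mem hk1 hZ hp _)
    · refine mul_mem (halfLatticeSum_mem hk1 hZ (mem_Icc.1 hm).1) (sum_mem fun e he => ?_)
      refine mul_mem (ratCast_mem _) (tsum_mem_of_mem_degSpan_one hk1 hZ ?_ (by omega))
      have h3 := mem_antidiagonal.1 he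
      have h4 := mem_Icc.1 hm
      exact coeff_prod_localSeries_mem_degSpan hk1 hZ hp (by omega)
  have h := mul_mem (ratCast_mem (A := A) 2⁻¹) h2T
  rwa [Rat.cast_inv, Rat.cast_ofNat, inv_mul_cancel_left₀ two_ne_zero] at h
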